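/- **Setting.** Let $N\ge 1$. For a lower triangular matrix $H=[h_{k,j}]\in\mathbb{R}^{(N-1)\times(N-1)}$ and an operator $T\colon\mathcal X\to\mathcal X$ on a real Hilbert space, consider the fixed-step algorithm $y_{k+1}=y_k-\sum_{j=0}^{k}h_{k+1,j+1}(y_j-Ty_j)$, $k=0,\dots,N-2$. Let $\mathcal H_\star(N-1)$ be the set of all such $H$ for which $\|y_{N-1}-Ty_{N-1}\|^2\le \frac{4\|y_0-y_\star\|^2}{N^2}$ holds for every real Hilbert space $\mathcal X$, every nonexpansive $T\colon\mathcal X\to\mathcal X$, every fixed point $y_\star$ of $T$ and every $y_0\in\mathcal X$; such $H$ are called optimal. For $m,j\in\{1,\dots,N-1\}$ let $$Q(m,j;H)=\sum_{j=j(1)\le i(1)<j(2)\le i(2)<\cdots<j(m)\le i(m)\le N-1}\ \prod_{r=1}^m h_{i(r),j(r)} .$$ The H-certificates of $H$ are $$\lambda^\star_{N,j}(H)=N\sum_{m=1}^{N-1}(-1)^{m-1}Q(m,j;H)\qquad(1\le j\le N-1),$$ $$\lambda^\star_{k,j}(H)=N\sum_{\ell=1}^{N-1}\sum_{m=1}^{N-1}(-1)^{\ell+m-1}\binom{\ell+m}{m}Q(\ell,j;H)\,Q(m,k;H)\qquad(1\le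 j<k\le N-1),$$ and $\rho(H)=\sum_{j=1}^{N-1}\sum_{k=j+1}^{N}\lambda^\star_{k,j}(H)$ is their sum. A matrix $H\in\mathcal H_\star(N-1)$ is an optimal vertex if for each $j\in\{1,\dots,N-1\}$ there is exactly one $k(j)\in\{j+1,\dots,N\}$ with $\lambda^\star_{k(j),j}(H)>0$, while $\lambda^\star_{\ell,j}(H)=0$ for all other $\ell\in\{j+1,\dots,N\}$. It is decomposable at $N'\in\{1,\dots,N-1\}$ if $\lambda^\star_{N,N'}(H)>0$, $\lambda^\star_{k,N'}(H)=0$ for $N'<k<N$, and $\lambda^\star_{k,j}(H)=0$ for all $1\le j<N'<k\le N$. Finally, $H_{\text{Dual-OHM}}(N-1)$ is the lower triangular matrix with entries $-\frac{N-k}{(N-j)(N-j+1)}$ for $j<k$ and $\frac{N-k}{N-k+1}$ for $j=k$. **Statement.** 1. If $H\in\mathcal H_\star(N-1)$ is an optimal vertex that is decomposable at $N'\in\{1,\dots,N-1\}$, then $$\rho(H)\ \ge\ N-1+\frac{N'(N'-1)}{N}.$$ 2. Every $H\in\mathcal H_\star(N-1)$ satisfies $\rho(H)\ge N-1$, with equality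 if and only if $H=H_{\text{Dual-OHM}}(N-1)$; moreover $H_{\text{Dual-OHM}}(N-1)$ itself belongs to $\mathcal H_\star(N-1)$ and is an optimal vertex. -/

import Mathlib

/-!
Throughout, `n = N - 1` is the number of steps of the algorithm, so `N = n + 1`. The matrix `H` has
rows and columns indexed by `Fin n`; its entry `H k j` with `k j : Fin n` is the step size
`h_{k+1, j+1}`. The indices `m, j, k` of the Q-functions and of the H-certificates are natural
numbers counted from one.
-/

namespace FixedPointH

/-- The iterates `y_0, …, y_n` are generated by the fixed-step algorithm with step sizes `H`:
`y_{k+1} = y_k - ∑_{j=0}^{k} h_{k+1,j+1} (y_j - T y_j)` for `k = 0, …, n - 1`. -/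
def IsRun {n : ℕ} (H : Matrix (Fin n) (Fin n) ℝ) {X : Type} [AddCommGroup X] [Module ℝ X]
    (T : X → X) (y : Fin (n + 1) → X) : Prop :=
  ∀ k : Fin n, y k.succ = y k.castSucc -
    ∑ j ∈ Finset.Iic k, H k j • (y j.castSucc - T (y j.castSucc))

/-- The set of minimax optimal `H`-matrices for `n = N - 1` steps: the lower triangular matrices
whose algorithm satisfies `‖y_{N-1} - T y_{N-1}‖² ≤ 4 ‖y_0 - y⋆‖² / N²` for every nonexpansive
operator `T` on a real Hilbert space and every fixed point `y⋆` of `T`. -/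
def optimalSet (n : ℕ) : Set (Matrix (Fin n) (Fin n) ℝ) :=
  {H | (∀ k j : Fin n, k < j → H k j = 0) ∧
    ∀ (X : Type) [NormedAddCommGroup X] [InnerProductSpace ℝ X] [CompleteSpace X]
      (T : X → X), (∀ u v : X, ‖T u - T v‖ ≤ ‖u - v‖) →
      ∀ yStar : X, T yStar = yStar →
      ∀ y : Fin (n + 1) → X, IsRun H T y →
        ‖y (Fin.last n) - T (y (Fin.last n))‖ ^ 2 ≤ 4 * ‖y 0 - yStar‖ ^ 2 / ((n : ℝ) + 1) ^ 2}

/-- An admissible choice of index pairs `(i(r), j(r))`, `r = 1, …, m`, in the definition of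
`Q(m, j; H)`, that is, `j = j(1) ≤ i(1) < j(2) ≤ i(2) < ⋯ < j(m) ≤ i(m)`. Here `(p r).1` is the
row index and `(p r).2` the column index (both counted from zero, while `j` is counted from one). -/
def IsChain {n : ℕ} (m j : ℕ) (p : Fin m → Fin n × Fin n) : Prop :=
  (∀ r : Fin m, r.val = 0 → (p r).2.val + 1 = j) ∧
  (∀ r : Fin m, (p r).2 ≤ (p r).1) ∧
  (∀ r s : Fin m, r.val + 1 = s.val → (p r).1 < (p s).2)

open Classical in
/-- The Q-function `Q(m, j; H)` for `1 ≤ m, j ≤ n`: the sum of the products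
`h_{i(1),j(1)} ⋯ h_{i(m),j(m)}` over all admissible choices of indices. -/
noncomputable def Q {n : ℕ} (H : Matrix (Fin n) (Fin n) ℝ) (m j : ℕ) : ℝ :=
  ∑ p : Fin m → Fin n × Fin n with IsChain m j p, ∏ r : Fin m, H (p r).1 (p r).2

/-- The H-certificate `λ⋆_{k,j}(H)` for `1 ≤ j < k ≤ N = n + 1`. -/
noncomputable def cert {n : ℕ} (H : Matrix (Fin n) (Fin n) ℝ) (k j : ℕ) : ℝ :=
  if k = n + 1 then
    ((n : ℝ) + 1) * ∑ m ∈ Finset.Icc 1 n, (-1 : ℝ) ^ (m - 1) * Q H m j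
  else
    ((n : ℝ) + 1) * ∑ l ∈ Finset.Icc 1 n, ∑ m ∈ Finset.Icc 1 n,
      (-1 : ℝ) ^ (l + m - 1) * ((l + m).choose m : ℝ) * Q H l j * Q H m k

/-- The sum `ρ(H)` of all H-certificates `λ⋆_{k,j}(H)`, `1 ≤ j < k ≤ N`. -/
noncomputable def rho {n : ℕ} (H : Matrix (Fin n) (Fin n) ℝ) : ℝ :=
  ∑ j ∈ Finset.Icc 1 n, ∑ k ∈ Finset.Icc (j + 1) (n + 1), cert H k j

/-- `H` is an optimal vertex (algorithm): it is optimal, and for every `j = 1, …, N - 1` exactly one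
of the certificates `λ⋆_{k,j}(H)`, `j < k ≤ N`, is positive, the others being zero. -/
def IsOptimalVertex {n : ℕ} (H : Matrix (Fin n) (Fin n) ℝ) : Prop :=
  H ∈ optimalSet n ∧
    ∀ j ∈ Finset.Icc 1 n, ∃ k ∈ Finset.Icc (j + 1) (n + 1), 0 < cert H k j ∧
      ∀ l ∈ Finset.Icc (j + 1) (n + 1), l ≠ k → cert H l j = 0

/-- `H` is decomposable at `N' ∈ {1, …, N - 1}`. -/
def DecomposableAt {n : ℕ} (H : Matrix (Fin n) (Fin n) ℝ) (N' : ℕ) : Prop :=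
  (1 ≤ N' ∧ N' ≤ n) ∧
  (0 < cert H (n + 1) N' ∧ ∀ k ∈ Finset.Icc (N' + 1) n, cert H k N' = 0) ∧
  (∀ j ∈ Finset.Ico 1 N', ∀ k ∈ Finset.Icc (N' + 1) (n + 1), cert H k j = 0)

/-- The H-matrix of Dual-OHM with `n = N - 1` steps: with `k, j` counted from one, the entries are
`-(N - k) / ((N - j) (N - j + 1))` for `j < k` and `(N - k) / (N - k + 1)` for `j = k`. -/
noncomputable def dualOHM (n : ℕ) : Matrix (Fin n) (Fin n) ℝ :=
  Matrix.of fun k j =>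
    if j < k then
      -(((n : ℝ) - (k : ℕ)) / (((n : ℝ) - (j : ℕ)) * ((n : ℝ) - (j : ℕ) + 1)))
    else if j = k then ((n : ℝ) - (k : ℕ)) / ((n : ℝ) - (k : ℕ) + 1)
    else 0

end FixedPointH

/-!
Put `N = n + 1`. Encode the Q-functions of the column `j` in the polynomial
`w_j = ∑_m (-1)^{m-1} Q(m, j) (1 - X)^m` (`stepPoly`), and set `w_N = -1`. By Vandermonde's
identity the certificates are `λ⋆_{k,j} = -N ⟨w_j, w_k⟩`, the inner product being that of
coefficient vectors (`cert_eq_lam`). The tail sums `b_i = -∑_{j > i} w_j` satisfy the transposed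
recursion of the algorithm (`IsDualRun`), `b_i` has degree at most `n - i`, and `b_0` is the
polynomial with `y_n = b_0(T) y_0` for linear `T`.

Testing an optimal `H` on the negacyclic shift of `ℝ^N` forces `b_0 = (1 + X + ⋯ + X^n) / N`
(`IsDualRun.coeff_zero_of_optimal`). With this value of `b_0`, a telescoping sum of squares yields
an identity which writes the gap in the convergence bound as a combination of the nonexpansiveness
inequalities between the iterates, with the certificates as multipliers
(`IsDualRun.certificate_identity`). Hence nonnegative certificates suffice for optimality
(`IsDualRun.norm_sq_le`), which applies to Dual-OHM, where `b_i` is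
`(1 + X + ⋯ + X^{n-i}) / (n - i + 1)`. Conversely, bending the negacyclic shift along a half-space
shows, to first order, that `λ⋆_{k,j} ≥ 0` for `j < k < N` (`IsDualRun.lam_nonneg`).

The certificates `λ⋆_{N,j}` of an optimal `H` sum to `N - 1` (`IsDualRun.sum_lam_last`), so
`ρ(H) ≥ N - 1`. Equality makes `w_1, …, w_{N-1}` orthogonal; since their degrees are `N - j` and
their coefficients sum to zero, this determines the `b_i` (`IsDualRun.coeff_eq_of_orthogonal`) and
then `H` (`IsDualRun.matrix_unique`). If `H` is decomposable at `N'`, orthogonality pushes `w_j` for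
`j < N'` into the degrees at least `N - N'`, where the known value of `∑_j w_j = -b_0` gives
`∑_{j < N'} λ⋆_{N',j} = N' (N' - 1) / N` (`IsDualRun.sum_lam_of_decomposable`).
-/

namespace FixedPointH
open Finset Polynomial

/-! ### Recursion for the Q-functions -/

section QRec
variable {n : ℕ} (H : Matrix (Fin n) (Fin n) ℝ)

lemma isChain_one_iff (j : Fin n) (p : Fin 1 → Fin n × Fin n) :
    IsChain 1 (j + 1) p ↔ (p 0).2 = j ∧ j ≤ (p 0).1 := by
  constructor
  · rintro ⟨h1, h2, -⟩
    have h := h1 0 rfl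
    have h2' := h2 0
    have h3 : (p 0).2 = j := Fin.ext (by omega)
    exact ⟨h3, h3 ▸ h2'⟩
  · rintro ⟨h1, h2⟩
    refine ⟨fun r hr => ?_, fun r => ?_, fun r s hrs => ?_⟩
    · obtain rfl : r = 0 := Subsingleton.elim _ _
      rw [h1]
    · obtain rfl : r = 0 := Subsingleton.elim _ _
      rw [h1]; exact h2
    · omega

lemma isChain_cons_iff (m : ℕ) (j : Fin n) (x : Fin n × Fin n) (p : Fin (m + 1) → Fin n × Fin n) :
    IsChain (m + 2) (j + 1) (Fin.cons x p : Fin (m + 2) → Fin n × Fin n) ↔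
      x.2 = j ∧ j ≤ x.1 ∧ x.1 < (p 0).2 ∧ IsChain (m + 1) ((p 0).2 + 1) p := by
  constructor
  · rintro ⟨h1, h2, h3⟩
    have h := h1 0 rfl
    simp only [Fin.cons_zero] at h
    have h4 : x.2 = j := Fin.ext (by omega)
    refine ⟨h4, ?_, ?_, ?_, ?_, ?_⟩
    · have := h2 0
      simp only [Fin.cons_zero] at this
      exact h4 ▸ this
    · have := h3 0 (Fin.succ 0) (by simp)
      simpa only [Fin.cons_zero, Fin.cons_succ] using this
    · intro r hr
      obtain rfl : r = 0 := Fin.ext hr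
      rfl
    · intro r
      simpa only [Fin.cons_succ] using h2 r.succ
    · intro r s hrs
      simpa only [Fin.cons_succ] using h3 r.succ s.succ (by simp [hrs])
  · rintro ⟨h1, h2, h3, h4, h5, h6⟩
    refine ⟨?_, ?_, ?_⟩
    · intro r hr
      obtain rfl : r = 0 := Fin.ext hr
      simp [h1]
    · intro r
      refine Fin.cases ?_ (fun r => ?_) r
      · simp only [Fin.cons_zero, h1]; exact h2
      · simpa only [Fin.cons_succ] using h5 r
    · intro r s
      refine Fin.cases ?_ (fun r => ?_) r
      · refine Fin.cases ?_ (fun s => ?_) s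
        · intro h; simp at h
        · intro h
          obtain rfl : s = 0 := Fin.ext (by simpa using h.symm)
          simpa only [Fin.cons_zero, Fin.cons_succ] using h3
      · refine Fin.cases ?_ (fun s => ?_) s
        · intro h; simp at h
        · intro h
          simpa only [Fin.cons_succ] using h6 r s (by simpa using h)

lemma Q_one (j : Fin n) : Q H 1 (j + 1) = ∑ i ∈ Ici j, H i j := by
  classical
  unfold Q
  refine Finset.sum_bij' (fun p _ => (p 0).1) (fun i _ => fun _ => (i, j)) ?_ ?_ ?_ ?_ ?_
  · intro p hp
    rw [mem_filter, isChain_one_iff] at hp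
    exact mem_Ici.2 hp.2.2
  · intro i hi
    rw [mem_filter, isChain_one_iff]
    exact ⟨mem_univ _, rfl, mem_Ici.1 hi⟩
  · intro p hp
    rw [mem_filter, isChain_one_iff] at hp
    funext r
    obtain rfl : r = 0 := Subsingleton.elim _ _
    exact Prod.ext rfl hp.2.1.symm
  · intro i hi
    rfl
  · intro p hp
    rw [mem_filter, isChain_one_iff] at hp
    simp [hp.2.1]

/-- Removing the first pair `(i(1), j(1))` of a chain leaves a chain of length one less that starts
at some column `k > i(1)`. -/
lemma Q_succ (m : ℕ) (j : Fin n) :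
    Q H (m + 2) (j + 1) = ∑ i ∈ Ici j, H i j * ∑ k ∈ Ioi i, Q H (m + 1) (k + 1) := by
  classical
  have key : ∀ i : Fin n, ∑ k ∈ Ioi i, Q H (m + 1) (k + 1) =
      ∑ p : Fin (m + 1) → Fin n × Fin n,
        if i < (p 0).2 ∧ IsChain (m + 1) ((p 0).2 + 1) p then ∏ r, H (p r).1 (p r).2 else 0 := by
    intro i
    simp only [Q, sum_filter]
    rw [sum_comm]
    refine sum_congr rfl fun p _ => ?_
    by_cases h : IsChain (m + 1) ((p 0).2 + 1) p
    · have : ∀ k : Fin n, IsChain (m + 1) (k + 1) p ↔ k = (p 0).2 := by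
        intro k
        constructor
        · intro h'
          exact Fin.ext (by have := h'.1 0 rfl; omega)
        · rintro rfl; exact h
      simp only [this, and_true]
      simp [Finset.sum_ite_eq', mem_Ioi]
    · have : ∀ k : Fin n, ¬ IsChain (m + 1) (k + 1) p := by
        intro k h'
        have hk : k = (p 0).2 := Fin.ext (by have := h'.1 0 rfl; omega)
        exact h (hk ▸ h')
      simp [this]
  simp only [key]
  rw [Q, sum_filter, ← (Fin.consEquiv (fun _ : Fin (m + 2) => Fin n × Fin n)).sum_comp,
    Fintype.sum_prod_type, Fintype.sum_prod_type]
  simp only [Fin.consEquiv, Equiv.coe_fn_mk, isChain_cons_iff, Fin.prod_univ_succ, Fin.cons_zero,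
    Fin.cons_succ]
  rw [← sum_filter_add_sum_filter_not univ (fun i => i ∈ Ici j)]
  rw [filter_univ_mem]
  conv_rhs => rw [← add_zero (∑ i ∈ Ici j, _)]
  congr 1
  · refine sum_congr rfl fun i hi => ?_
    rw [mem_Ici] at hi
    rw [Finset.sum_eq_single j]
    · rw [mul_sum]
      refine sum_congr rfl fun p _ => ?_
      simp [hi]
    · intro k _ hk
      simp [hk]
    · simp
  · refine sum_eq_zero fun i hi => ?_
    have : ¬ j ≤ i := by simpa using hi
    simp [this]

/-- The columns of a chain increase strictly, so a chain of `m + 1` pairs starting at the column `j`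
(from zero) needs `m + 1 + j ≤ n`. -/
lemma Q_eq_zero (m : ℕ) (j : Fin n) (h : n < m + 1 + j) : Q H (m + 1) (j + 1) = 0 := by
  induction m generalizing j with
  | zero => omega
  | succ m ih =>
    rw [Q_succ]
    refine sum_eq_zero fun i hi => ?_
    rw [sum_eq_zero, mul_zero]
    intro k hk
    have h1 : j.val ≤ i := Fin.le_def.1 (mem_Ici.1 hi)
    have h2 : i.val < k := Fin.lt_def.1 (mem_Ioi.1 hk)
    exact ih k (by omega)

end QRec

/-! ### The dual run -/

lemma coeff_one_sub_X_mul_zero (f : ℝ[X]) : ((1 - X) * f).coeff 0 = f.coeff 0 := by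
  simp [sub_mul]

lemma coeff_one_sub_X_mul_succ (f : ℝ[X]) (d : ℕ) :
    ((1 - X) * f).coeff (d + 1) = f.coeff (d + 1) - f.coeff d := by
  simp [sub_mul]

/-- The polynomial `∑_{m ≥ 1} (-1)^{m-1} Q(m, j+1; H) (1 - X)^m` collecting the Q-functions of the
column `j`. Here `X` stands for a linear operator `T`: a perturbation `(1 - T) v` of `y_j - T y_j`
changes the last iterate by minus the value of this polynomial at `T`, applied to `v`. -/
noncomputable def stepPoly {n : ℕ} (H : Matrix (Fin n) (Fin n) ℝ) (j : Fin n) : ℝ[X] :=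
  ∑ m ∈ range n, C ((-1) ^ m * Q H (m + 1) (j + 1)) * (1 - X) ^ (m + 1)

/-- The dual recursion of `H`, run backwards from `b_n = 1`:
`b_j = b_{j+1} - (1 - X) ∑_{i ≥ j} H_{i,j} b_{i+1}`. It is the transpose of the algorithm applied to
the operator "multiplication by `X`". -/
structure IsDualRun {n : ℕ} (H : Matrix (Fin n) (Fin n) ℝ) (b : Fin (n + 1) → ℝ[X]) : Prop where
  last : b (Fin.last n) = 1
  step : ∀ j : Fin n, b j.castSucc = b j.succ - (1 - X) * ∑ i ∈ Ici j, C (H i j) * b i.succ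

/-- The solution of the dual recursion, as partial sums of the column polynomials. -/
noncomputable def dualRun {n : ℕ} (H : Matrix (Fin n) (Fin n) ℝ) (i : Fin (n + 1)) : ℝ[X] :=
  1 - ∑ k : Fin n with i ≤ k.castSucc, stepPoly H k

section Dual
variable {n : ℕ} {H : Matrix (Fin n) (Fin n) ℝ}

lemma dualRun_castSucc (j : Fin n) :
    dualRun H j.castSucc = dualRun H j.succ - stepPoly H j := by
  have : (univ.filter fun k : Fin n => j.castSucc ≤ k.castSucc) =
      insert j (univ.filter fun k : Fin n => j.succ ≤ k.castSucc) := by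
    ext k
    simp only [mem_filter, mem_univ, true_and, mem_insert, Fin.le_def, Fin.val_castSucc,
      Fin.val_succ, Fin.ext_iff]
    omega
  rw [dualRun, this, sum_insert (by simp [Fin.le_def]), dualRun]
  ring

lemma stepPoly_eq (j : Fin n) :
    stepPoly H j = (1 - X) * ∑ i ∈ Ici j, C (H i j) * dualRun H i.succ := by
  have h1 : stepPoly H j =
      (1 - X) * ∑ m ∈ range (n + 1), C ((-1) ^ m * Q H (m + 1) (j + 1)) * (1 - X) ^ m := by
    rw [sum_range_succ, Q_eq_zero H n j (by omega), stepPoly, mul_zero, map_zero, zero_mul,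
      add_zero, mul_sum]
    exact sum_congr rfl fun m _ => by ring
  have h2 : ∀ i : Fin n, (univ.filter fun k : Fin n => i.succ ≤ k.castSucc) = Ioi i := by
    intro i
    ext k
    simp only [mem_filter, mem_univ, true_and, mem_Ioi, Fin.succ_le_castSucc_iff]
  rw [h1, sum_range_succ']
  congr 1
  simp only [dualRun, h2, stepPoly, Q_one, Q_succ, pow_zero, one_mul, mul_one, mul_sub, zero_add]
  rw [sum_sub_distrib, map_sum, add_comm, sub_eq_add_neg]
  congr 1
  rw [← sum_neg_distrib]
  simp only [mul_sum, sum_mul, map_sum]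
  rw [sum_comm]
  refine sum_congr rfl fun i _ => ?_
  rw [← sum_neg_distrib, sum_comm]
  refine sum_congr rfl fun k _ => ?_
  rw [← sum_neg_distrib]
  refine sum_congr rfl fun m _ => ?_
  simp only [map_mul, map_pow, map_neg, map_one]
  ring

variable (H) in
lemma isDualRun_dualRun : IsDualRun H (dualRun H) where
  last := by
    rw [dualRun, filter_false_of_mem, sum_empty, sub_zero]
    intro k _ h
    exact absurd (Fin.castSucc_lt_last k) (not_lt.2 h)
  step j := by rw [dualRun_castSucc, stepPoly_eq]

namespace IsDualRun
variable {b : Fin (n + 1) → ℝ[X]}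

lemma unique {b' : Fin (n + 1) → ℝ[X]} (hb : IsDualRun H b) (hb' : IsDualRun H b') : b = b' := by
  have key : ∀ m : ℕ, ∀ i : Fin (n + 1), n - i ≤ m → b i = b' i := by
    intro m
    induction m with
    | zero =>
      intro i hi
      obtain rfl : i = Fin.last n := Fin.ext (by simp; omega)
      rw [hb.last, hb'.last]
    | succ m ih =>
      intro i
      refine Fin.lastCases (fun _ => by rw [hb.last, hb'.last]) (fun j hj => ?_) i
      rw [Fin.val_castSucc] at hj
      rw [hb.step, hb'.step, ih j.succ (by rw [Fin.val_succ]; omega)]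
      congr 2
      refine sum_congr rfl fun i hi => ?_
      have : j.val ≤ i := Fin.le_def.1 (mem_Ici.1 hi)
      rw [ih i.succ (by rw [Fin.val_succ]; omega)]
  exact funext fun i => key _ i le_rfl

/-- The polynomial `b_i` has degree at most `n - i`. -/
lemma coeff_eq_zero (hb : IsDualRun H b) (i : Fin (n + 1)) (d : ℕ) (h : n < d + i) :
    (b i).coeff d = 0 := by
  have key : ∀ m : ℕ, ∀ i : Fin (n + 1), n - i ≤ m → ∀ d : ℕ, n < d + i → (b i).coeff d = 0 := by
    intro m
    induction m with
    | zero =>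
      intro i hi d hd
      obtain rfl : i = Fin.last n := Fin.ext (by simp; omega)
      rw [hb.last, coeff_one, if_neg]
      simp at hd; omega
    | succ m ih =>
      intro i
      refine Fin.lastCases (fun _ d hd => ?_) (fun j hj d hd => ?_) i
      · rw [hb.last, coeff_one, if_neg]
        simp at hd; omega
      rw [Fin.val_castSucc] at hj hd
      obtain ⟨e, rfl⟩ : ∃ e, d = e + 1 := ⟨d - 1, by omega⟩
      rw [hb.step, coeff_sub, coeff_one_sub_X_mul_succ, ih j.succ (by rw [Fin.val_succ]; omega) _
        (by rw [Fin.val_succ]; omega), finsetSum_coeff, finsetSum_coeff, sum_eq_zero, sum_eq_zero]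
      · simp
      all_goals
        intro i hi
        have : j.val ≤ i := Fin.le_def.1 (mem_Ici.1 hi)
        rw [coeff_C_mul, ih i.succ (by rw [Fin.val_succ]; omega) _ (by rw [Fin.val_succ]; omega),
          mul_zero]
  exact key _ i le_rfl d h

lemma eval_one (hb : IsDualRun H b) (i : Fin (n + 1)) : (b i).eval 1 = 1 := by
  refine Fin.reverseInduction (by simp [hb.last]) (fun j hj => ?_) i
  rw [hb.step, eval_sub, hj, eval_mul]
  simp

lemma sum_coeff (hb : IsDualRun H b) (i : Fin (n + 1)) :
    ∑ d ∈ range (n + 1), (b i).coeff d = 1 := by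
  have h : (b i).natDegree < n + 1 := by
    rw [Nat.lt_succ_iff, natDegree_le_iff_coeff_eq_zero]
    intro d hd
    exact hb.coeff_eq_zero i d (by omega)
  rw [← hb.eval_one i, eval_eq_sum_range' h]
  simp

/-- The coefficient of `b_j` in the top degree `n - j` is `H_{j,j}` times that of `b_{j+1}`. -/
lemma coeff_top (hb : IsDualRun H b) (j : Fin n) (e : ℕ) (he : e + 1 + j = n) :
    (b j.castSucc).coeff (e + 1) = H j j * (b j.succ).coeff e := by
  have hz : ∀ i : Fin n, j ≤ i → (b i.succ).coeff (e + 1) = 0 := by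
    intro i hi
    have : j.val ≤ i := hi
    exact hb.coeff_eq_zero _ _ (by rw [Fin.val_succ]; omega)
  rw [hb.step, coeff_sub, coeff_one_sub_X_mul_succ, hz j le_rfl, finsetSum_coeff, finsetSum_coeff]
  rw [sum_eq_zero (f := fun i => (C (H i j) * b i.succ).coeff (e + 1)), sum_eq_single j]
  · rw [coeff_C_mul]; ring
  · intro i hi hij
    have h1 : j.val ≤ i := Fin.le_def.1 (mem_Ici.1 hi)
    have h2 : i.val ≠ j := fun h => hij (Fin.ext h)
    rw [coeff_C_mul, hb.coeff_eq_zero _ _ (by rw [Fin.val_succ]; omega), mul_zero]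
  · simp
  · intro i hi
    rw [coeff_C_mul, hz i (mem_Ici.1 hi), mul_zero]

end IsDualRun
end Dual

/-! ### The certificates as a Gram matrix -/

/-- The increments `b_{j+1} - b_j` of a dual run, `j = 0, …, n - 1`, completed by `-1` at `j = n`
(as if `b_{n+1} = 0`). Up to the factor `-(n + 1)` the certificates are their inner products. -/
noncomputable def weight {n : ℕ} (b : Fin (n + 1) → ℝ[X]) : Fin (n + 1) → ℝ[X] :=
  Fin.snoc (α := fun _ => ℝ[X]) (fun j : Fin n => b j.succ - b j.castSucc) (-1)

/-- The inner product of the coefficient vectors of two polynomials of degree at most `n`. -/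
noncomputable def dot (n : ℕ) (f g : ℝ[X]) : ℝ := ∑ d ∈ range (n + 1), f.coeff d * g.coeff d

lemma dot_comm (n : ℕ) (f g : ℝ[X]) : dot n f g = dot n g f :=
  sum_congr rfl fun _ _ => mul_comm _ _

section Weight
variable {n : ℕ} {H : Matrix (Fin n) (Fin n) ℝ} {b : Fin (n + 1) → ℝ[X]}

@[simp] lemma weight_castSucc (j : Fin n) : weight b j.castSucc = b j.succ - b j.castSucc :=
  Fin.snoc_castSucc (α := fun _ => ℝ[X]) _ _ _

@[simp] lemma weight_last : weight b (Fin.last n) = -1 := Fin.snoc_last (α := fun _ => ℝ[X]) _ _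

lemma weight_dualRun (j : Fin n) : weight (dualRun H) j.castSucc = stepPoly H j := by
  rw [weight_castSucc, dualRun_castSucc]; ring

namespace IsDualRun

lemma weight_coeff_eq_zero (hb : IsDualRun H b) (j : Fin (n + 1)) (d : ℕ) (h : n < d + j) :
    (weight b j).coeff d = 0 := by
  revert h
  refine Fin.lastCases (fun h => ?_) (fun j h => ?_) j
  · simp only [Fin.val_last] at h
    rw [weight_last, coeff_neg, coeff_one, if_neg (by omega), neg_zero]
  · rw [Fin.val_castSucc] at h
    rw [weight_castSucc, coeff_sub, hb.coeff_eq_zero _ _ (by rw [Fin.val_succ]; omega),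
      hb.coeff_eq_zero _ _ (by rw [Fin.val_castSucc]; omega), sub_zero]

lemma sum_weight (hb : IsDualRun H b) : ∑ j, weight b j = -b 0 := by
  have h := (Fin.sum_univ_succ b).symm.trans (Fin.sum_univ_castSucc b)
  rw [hb.last] at h
  rw [Fin.sum_univ_castSucc]
  simp only [weight_castSucc, weight_last, sum_sub_distrib]
  linear_combination h

lemma sum_coeff_weight (hb : IsDualRun H b) (j : Fin n) :
    ∑ d ∈ range (n + 1), (weight b j.castSucc).coeff d = 0 := by
  simp only [weight_castSucc, coeff_sub, sum_sub_distrib, hb.sum_coeff, sub_self]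

end IsDualRun

lemma coeff_one_sub_X_pow (l d : ℕ) :
    ((1 - X : ℝ[X]) ^ l).coeff d = (-1) ^ d * (l.choose d : ℝ) := by
  induction l generalizing d with
  | zero => cases d <;> simp [coeff_one]
  | succ l ih =>
    rw [pow_succ']
    cases d with
    | zero => rw [coeff_one_sub_X_mul_zero, ih]; simp
    | succ d =>
      rw [coeff_one_sub_X_mul_succ, ih, ih, Nat.choose_succ_succ]
      push_cast
      ring

/-- Vandermonde's identity: the binomial factor of the certificates is the inner product of powers
of `1 - X`. -/
lemma dot_one_sub_X_pow {n l m : ℕ} (hl : l ≤ n) :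
    dot n ((1 - X) ^ l) ((1 - X) ^ m) = ((l + m).choose m : ℝ) := by
  have h1 : dot n ((1 - X) ^ l) ((1 - X) ^ m) =
      ∑ d ∈ range (n + 1), ((l.choose d * m.choose d : ℕ) : ℝ) := by
    refine sum_congr rfl fun d _ => ?_
    rw [coeff_one_sub_X_pow, coeff_one_sub_X_pow]
    push_cast
    have : ((-1 : ℝ) ^ d) * (-1) ^ d = 1 := by rw [← mul_pow]; simp
    linear_combination (l.choose d * m.choose d : ℝ) * this
  rw [h1, ← Nat.cast_sum]
  norm_cast
  rw [← sum_subset (range_subset_range.2 (Nat.succ_le_succ hl)), ← Nat.choose_symm_add,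
    Nat.add_choose_eq, Finset.Nat.sum_antidiagonal_eq_sum_range_succ
      (fun i j => l.choose i * m.choose j), ← Finset.sum_range_reflect]
  · refine sum_congr rfl fun d hd => ?_
    have : d ≤ l := by simpa [Nat.lt_succ_iff] using hd
    rw [Nat.succ_eq_add_one, show l + 1 - 1 - d = l - d by omega, Nat.choose_symm this]
  · intro d _ hd
    rw [Nat.choose_eq_zero_of_lt (by simpa using hd), zero_mul]

lemma dot_sum_C_mul {n : ℕ} (s : Finset ℕ) (c e : ℕ → ℝ) (f g : ℕ → ℝ[X]) :
    dot n (∑ l ∈ s, C (c l) * f l) (∑ m ∈ s, C (e m) * g m) =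
      ∑ l ∈ s, ∑ m ∈ s, c l * e m * dot n (f l) (g m) := by
  simp only [dot, finsetSum_coeff, coeff_C_mul, sum_mul_sum]
  simp only [mul_sum]
  rw [sum_comm]
  refine sum_congr rfl fun l _ => ?_
  rw [sum_comm]
  refine sum_congr rfl fun m _ => sum_congr rfl fun d _ => by ring

lemma sum_Icc_one_eq (n : ℕ) (f : ℕ → ℝ) : ∑ m ∈ Icc 1 n, f m = ∑ m ∈ range n, f (m + 1) := by
  rw [range_eq_Ico, sum_Ico_add' f 0 n 1, zero_add, Ico_add_one_right_eq_Icc]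

lemma cert_eq_dot (H : Matrix (Fin n) (Fin n) ℝ) (j : Fin n) (k : Fin (n + 1)) :
    cert H (k + 1) (j + 1) =
      -((n : ℝ) + 1) * dot n (weight (dualRun H) j.castSucc) (weight (dualRun H) k) := by
  rw [weight_dualRun]
  refine Fin.lastCases ?_ (fun k => ?_) k
  · rw [cert, Fin.val_last, if_pos rfl, weight_last, dot, sum_range_succ', sum_Icc_one_eq]
    have : ∀ d, (-1 : ℝ[X]).coeff (d + 1) = 0 := fun d => by simp [coeff_one]
    simp only [this, stepPoly, finsetSum_coeff, coeff_C_mul, coeff_one_sub_X_pow]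
    simp
    ring
  · rw [weight_dualRun, cert, Fin.val_castSucc, if_neg (by omega), stepPoly, stepPoly,
      dot_sum_C_mul, sum_Icc_one_eq, neg_mul, ← mul_neg, ← sum_neg_distrib]
    congr 1
    refine sum_congr rfl fun l hl => ?_
    rw [sum_Icc_one_eq, ← sum_neg_distrib]
    refine sum_congr rfl fun m _ => ?_
    rw [dot_one_sub_X_pow (Nat.succ_le_iff.2 (mem_range.1 hl)),
      show l + 1 + (m + 1) - 1 = l + m + 1 by omega, pow_succ, pow_add]
    ring

end Weight

/-! ### The certificate identity -/

section Certificate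
variable {n : ℕ} {H : Matrix (Fin n) (Fin n) ℝ} {b : Fin (n + 1) → ℝ[X]}
  {V : Type*} [NormedAddCommGroup V] [InnerProductSpace ℝ V]

/-- The certificate attached to the pair `{j, k}` (counted from zero), defined for all pairs so as
to be symmetric in `j` and `k`; see `cert_eq_lam`. -/
noncomputable def lam (b : Fin (n + 1) → ℝ[X]) (j k : Fin (n + 1)) : ℝ :=
  -((n : ℝ) + 1) * dot n (weight b j) (weight b k)

lemma lam_comm (j k : Fin (n + 1)) : lam b j k = lam b k j := by rw [lam, dot_comm]; rfl

/-- The row sums of the certificates (diagonal included) are the coefficient sums of the weights,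
because the weights add up to `-b_0`, a multiple of the all-ones vector. -/
lemma IsDualRun.sum_lam (hb : IsDualRun H b)
    (h0 : ∀ d ≤ n, (b 0).coeff d = 1 / ((n : ℝ) + 1)) (j : Fin (n + 1)) :
    ∑ k, lam b j k = ∑ d ∈ range (n + 1), (weight b j).coeff d := by
  have hN : (n : ℝ) + 1 ≠ 0 := by positivity
  simp only [lam, dot, ← mul_sum]
  rw [sum_comm, mul_sum]
  refine sum_congr rfl fun d hd => ?_
  rw [← mul_sum, ← finsetSum_coeff, hb.sum_weight, coeff_neg,
    h0 d (Nat.lt_succ_iff.1 (mem_range.1 hd))]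
  field_simp

/-- The weighted graph Laplacian with the certificates as edge weights is a sum of squares up to
one vertex term. -/
lemma IsDualRun.sum_lam_mul_norm_sq (hb : IsDualRun H b)
    (h0 : ∀ d ≤ n, (b 0).coeff d = 1 / ((n : ℝ) + 1)) (u : Fin (n + 1) → V) :
    ∑ j, ∑ k, lam b j k * ‖u j - u k‖ ^ 2 =
      2 * ((n : ℝ) + 1) * ∑ d ∈ range (n + 1), ‖∑ j, (weight b j).coeff d • u j‖ ^ 2
        - 2 * ‖u (Fin.last n)‖ ^ 2 := by
  have h1 : ∑ j, ∑ k, lam b j k * ‖u j‖ ^ 2 = -‖u (Fin.last n)‖ ^ 2 := by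
    simp only [← sum_mul, hb.sum_lam h0]
    rw [Fin.sum_univ_castSucc]
    simp only [hb.sum_coeff_weight, zero_mul, sum_const_zero, zero_add, weight_last, coeff_neg,
      coeff_one]
    simp
  have h2 : ∑ j, ∑ k, lam b j k * ‖u k‖ ^ 2 = -‖u (Fin.last n)‖ ^ 2 := by
    rw [sum_comm, ← h1]
    exact sum_congr rfl fun j _ => sum_congr rfl fun k _ => by rw [lam_comm]
  have h3 : ∑ j, ∑ k, lam b j k * inner ℝ (u j) (u k) =
      -((n : ℝ) + 1) * ∑ d ∈ range (n + 1), ‖∑ j, (weight b j).coeff d • u j‖ ^ 2 := by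
    simp only [← real_inner_self_eq_norm_sq, sum_inner, inner_sum, real_inner_smul_left,
      real_inner_smul_right, lam, dot, mul_sum, sum_mul]
    rw [sum_comm' (s := range (n + 1)) (t := fun _ => univ) (t' := univ)
      (s' := fun _ => range (n + 1)) (by simp)]
    refine sum_congr rfl fun j _ => ?_
    rw [sum_comm]
    refine sum_congr rfl fun d _ => sum_congr rfl fun k _ => ?_
    rw [real_inner_comm]
    ring
  have h4 : ∀ j k, lam b j k * ‖u j - u k‖ ^ 2 = lam b j k * ‖u j‖ ^ 2 + lam b j k * ‖u k‖ ^ 2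
      - 2 * (lam b j k * inner ℝ (u j) (u k)) := by
    intro j k
    rw [norm_sub_sq_real]; ring
  simp only [h4, sum_sub_distrib, sum_add_distrib, h1, h2, ← mul_sum, h3]
  ring

/-- The certificate identity. With `G_j = y_j - T y_j` and the fixed point moved to the origin it
expresses the gap in the convergence bound through the quantities `‖y_j - y_k‖² - ‖T y_j - T y_k‖²`,
nonnegative for nonexpansive `T`, with the certificates as multipliers. If `A_d` and `B_d` are the
sums of the `y_j` and of the `G_j` weighted by the `d`-th coefficients of the weights, then
`A_{d+1} - B_{d+1} = A_d`, so that the sums of squares telescope. -/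
theorem IsDualRun.certificate_identity (hb : IsDualRun H b)
    (h0 : ∀ d ≤ n, (b 0).coeff d = 1 / ((n : ℝ) + 1)) (y G : Fin (n + 1) → V)
    (hy : ∀ k : Fin n, y k.succ = y k.castSucc - ∑ j ∈ Iic k, H k j • G j.castSucc) :
    ‖y 0‖ ^ 2 / ((n : ℝ) + 1)
        - ((n : ℝ) + 1) * ‖G (Fin.last n) - ((1 : ℝ) / (n + 1)) • y 0‖ ^ 2 =
      (∑ j, ∑ k, lam b j k * (‖y j - y k‖ ^ 2 - ‖(y j - G j) - (y k - G k)‖ ^ 2)) / 2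
        + (‖y (Fin.last n)‖ ^ 2 - ‖y (Fin.last n) - G (Fin.last n)‖ ^ 2) := by
  have hN : (n : ℝ) + 1 ≠ 0 := by positivity
  set A : ℕ → V := fun d => ∑ j, (weight b j).coeff d • y j with hA
  set B : ℕ → V := fun d => ∑ j, (weight b j).coeff d • G j with hB
  set β : Fin n → ℝ[X] := fun j => ∑ i ∈ Ici j, C (H i j) * b i.succ with hβ
  have hw : ∀ j : Fin n, weight b j.castSucc = (1 - X) * β j := by
    intro j
    rw [weight_castSucc, hb.step]; ring
  -- summation by parts turns increments of `b` into increments of `y`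
  have hA' : ∀ d, A d = -((b 0).coeff d • y 0) + ∑ j : Fin n, (β j).coeff d • G j.castSucc := by
    intro d
    have t := (Fin.sum_univ_succ fun j => (b j).coeff d • y j).symm.trans
      (Fin.sum_univ_castSucc fun j => (b j).coeff d • y j)
    have e1 : ∑ j : Fin n, (β j).coeff d • G j.castSucc =
        ∑ i : Fin n, (b i.succ).coeff d • (y i.castSucc - y i.succ) := by
      simp only [hy, sub_sub_cancel, hβ, finsetSum_coeff, coeff_C_mul, sum_smul, smul_sum]
      rw [sum_comm' (t' := univ) (s' := fun i => Iic i) (by simp)]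
      exact sum_congr rfl fun i _ => sum_congr rfl fun j _ => by rw [smul_smul, mul_comm]
    rw [e1]
    simp only [hA]
    rw [Fin.sum_univ_castSucc]
    simp only [weight_castSucc, weight_last, coeff_sub, coeff_neg, sub_smul, neg_smul, smul_sub,
      sum_sub_distrib]
    rw [hb.last] at t
    have t' : ∑ x : Fin n, (b x.succ).coeff d • y x.succ =
        ∑ x : Fin n, (b x.castSucc).coeff d • y x.castSucc
          + (1 : ℝ[X]).coeff d • y (Fin.last n) - (b 0).coeff d • y 0 := by
      rw [← t]; abel
    rw [t']
    abel
  have hBz : B 0 = ∑ j : Fin n, (β j).coeff 0 • G j.castSucc - G (Fin.last n) := by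
    simp only [hB]
    rw [Fin.sum_univ_castSucc]
    simp only [hw, coeff_one_sub_X_mul_zero, weight_last, coeff_neg, coeff_one_zero, neg_smul,
      one_smul]
    abel
  have hBs : ∀ d, B (d + 1) = ∑ j : Fin n, (β j).coeff (d + 1) • G j.castSucc
      - ∑ j : Fin n, (β j).coeff d • G j.castSucc := by
    intro d
    simp only [hB]
    rw [Fin.sum_univ_castSucc]
    simp [hw, coeff_one_sub_X_mul_succ, coeff_one, sub_smul]
  have k0 : A 0 - B 0 = G (Fin.last n) - ((1 : ℝ) / (n + 1)) • y 0 := by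
    rw [hA', hBz, h0 0 (Nat.zero_le _)]; abel
  have ks : ∀ d < n, A (d + 1) - B (d + 1) = A d := by
    intro d hd
    rw [hA', hA', hBs, h0 _ hd.le, h0 _ hd]; abel
  have kn : A n = -(((1 : ℝ) / (n + 1)) • y 0) := by
    rw [hA', h0 n le_rfl, sum_eq_zero, add_zero]
    intro j _
    simp only [hβ, finsetSum_coeff]
    rw [sum_eq_zero, zero_smul]
    intro i _
    rw [coeff_C_mul, hb.coeff_eq_zero _ _ (by rw [Fin.val_succ]; omega), mul_zero]
  have e1 := hb.sum_lam_mul_norm_sq h0 y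
  have e2 := hb.sum_lam_mul_norm_sq h0 (fun j => y j - G j)
  have e3 : ∑ d ∈ range (n + 1), ‖∑ j, (weight b j).coeff d • (y j - G j)‖ ^ 2 =
      ‖G (Fin.last n) - ((1 : ℝ) / (n + 1)) • y 0‖ ^ 2 + ∑ d ∈ range n, ‖A d‖ ^ 2 := by
    have : ∀ d, ∑ j, (weight b j).coeff d • (y j - G j) = A d - B d := by
      intro d
      simp only [hA, hB, smul_sub, sum_sub_distrib]
    simp only [this]
    rw [sum_range_succ', k0, add_comm]
    congr 1
    exact sum_congr rfl fun d hd => by rw [ks d (mem_range.1 hd)]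
  have e4 : ∑ d ∈ range (n + 1), ‖A d‖ ^ 2 =
      ∑ d ∈ range n, ‖A d‖ ^ 2 + ‖y 0‖ ^ 2 / ((n : ℝ) + 1) ^ 2 := by
    rw [sum_range_succ, kn, norm_neg, norm_smul, mul_pow]
    congr 1
    rw [Real.norm_eq_abs, sq_abs, div_pow]; ring
  simp only [mul_sub, sum_sub_distrib]
  rw [e1, e2, e3, e4]
  field_simp
  ring

/-- Nonnegative certificates and the right value of `b_0` imply the optimal rate: the certificate
identity gives `‖G_n - v / N‖ ≤ ‖v‖ / N` for `v = y_0 - z` and `N = n + 1`. -/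
theorem IsDualRun.norm_sq_le (hb : IsDualRun H b)
    (h0 : ∀ d ≤ n, (b 0).coeff d = 1 / ((n : ℝ) + 1))
    (hl : ∀ j k, j < k → 0 ≤ lam b j k) (T : V → V)
    (hT : ∀ u v, ‖T u - T v‖ ≤ ‖u - v‖) (z : V) (hz : T z = z) (y : Fin (n + 1) → V)
    (hy : ∀ k : Fin n, y k.succ = y k.castSucc -
      ∑ j ∈ Iic k, H k j • (y j.castSucc - T (y j.castSucc))) :
    ‖y (Fin.last n) - T (y (Fin.last n))‖ ^ 2 ≤ 4 * ‖y 0 - z‖ ^ 2 / ((n : ℝ) + 1) ^ 2 := by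
  have hN : (0 : ℝ) < (n : ℝ) + 1 := by positivity
  have id := hb.certificate_identity h0 (fun k => y k - z) (fun k => y k - T (y k))
    (fun k => by rw [hy k]; abel)
  have hT2 : ∀ u v, 0 ≤ ‖u - v‖ ^ 2 - ‖T u - T v‖ ^ 2 := fun u v =>
    sub_nonneg.2 (pow_le_pow_left₀ (norm_nonneg _) (hT u v) 2)
  have p1 : 0 ≤ (∑ j, ∑ k, lam b j k * (‖(y j - z) - (y k - z)‖ ^ 2
      - ‖(y j - z - (y j - T (y j))) - (y k - z - (y k - T (y k)))‖ ^ 2)) / 2 := by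
    refine div_nonneg (sum_nonneg fun j _ => sum_nonneg fun k _ => ?_) two_pos.le
    rw [show y j - z - (y k - z) = y j - y k by abel,
      show (y j - z - (y j - T (y j))) - (y k - z - (y k - T (y k))) = T (y j) - T (y k) by abel]
    rcases lt_trichotomy j k with h | rfl | h
    · exact mul_nonneg (hl _ _ h) (hT2 _ _)
    · simp
    · rw [lam_comm]; exact mul_nonneg (hl _ _ h) (hT2 _ _)
  have p2 : 0 ≤ ‖y (Fin.last n) - z‖ ^ 2
      - ‖y (Fin.last n) - z - (y (Fin.last n) - T (y (Fin.last n)))‖ ^ 2 := by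
    have := hT2 (y (Fin.last n)) z
    rwa [hz, show T (y (Fin.last n)) - z =
      y (Fin.last n) - z - (y (Fin.last n) - T (y (Fin.last n))) by abel] at this
  set g := y (Fin.last n) - T (y (Fin.last n))
  set v := y 0 - z
  have h1 : ‖g - ((1 : ℝ) / (n + 1)) • v‖ ^ 2 ≤ (‖v‖ / (n + 1)) ^ 2 := by
    have : ((n : ℝ) + 1) * ‖g - ((1 : ℝ) / (n + 1)) • v‖ ^ 2 ≤ ‖v‖ ^ 2 / (n + 1) := by linarith
    rw [div_pow, sq ((n : ℝ) + 1), ← div_div, le_div_iff₀ hN]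
    linarith
  have h2 : ‖g - ((1 : ℝ) / (n + 1)) • v‖ ≤ ‖v‖ / (n + 1) :=
    le_of_sq_le_sq h1 (by positivity)
  have h3 : ‖g‖ ≤ 2 * (‖v‖ / (n + 1)) := by
    calc ‖g‖ = ‖(g - ((1 : ℝ) / (n + 1)) • v) + ((1 : ℝ) / (n + 1)) • v‖ := by
          rw [sub_add_cancel]
      _ ≤ ‖g - ((1 : ℝ) / (n + 1)) • v‖ + ‖((1 : ℝ) / (n + 1)) • v‖ := norm_add_le _ _
      _ ≤ ‖v‖ / (n + 1) + ‖v‖ / (n + 1) := by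
          refine add_le_add h2 (le_of_eq ?_)
          rw [norm_smul, Real.norm_of_nonneg (by positivity)]; ring
      _ = _ := by ring
  calc ‖g‖ ^ 2 ≤ (2 * (‖v‖ / (n + 1))) ^ 2 := pow_le_pow_left₀ (norm_nonneg _) h3 2
    _ = _ := by rw [mul_pow, div_pow]; ring

end Certificate

/-! ### Runs with linear operators -/

section Runs
variable {n : ℕ} (H : Matrix (Fin n) (Fin n) ℝ)

lemma exists_isRun {V : Type} [AddCommGroup V] [Module ℝ V] (T : V → V) (x : V) :
    ∃ y : Fin (n + 1) → V, y 0 = x ∧ IsRun H T y := by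
  have key : ∀ m : ℕ, ∃ y : ℕ → V, y 0 = x ∧ ∀ k : Fin n, k.val < m →
      y (k + 1) = y k - ∑ j ∈ Iic k, H k j • (y j - T (y j)) := by
    intro m
    induction m with
    | zero => exact ⟨fun _ => x, rfl, fun k hk => absurd hk (Nat.not_lt_zero _)⟩
    | succ m ih =>
      obtain ⟨y, h0, hy⟩ := ih
      by_cases hm : m < n
      · obtain ⟨v, hv⟩ : ∃ v, v = y m - ∑ j ∈ Iic (⟨m, hm⟩ : Fin n),
            H ⟨m, hm⟩ j • (y j - T (y j)) := ⟨_, rfl⟩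
        refine ⟨Function.update y (m + 1) v, ?_, ?_⟩
        · rw [Function.update_of_ne (by omega), h0]
        · intro k hk
          have hu : ∀ j ∈ Iic k, Function.update y (m + 1) v j.val = y j := by
            intro j hj
            have : j.val ≤ k := Fin.le_def.1 (mem_Iic.1 hj)
            rw [Function.update_of_ne (by omega)]
          have hs : ∑ j ∈ Iic k, H k j • (Function.update y (m + 1) v j.val -
              T (Function.update y (m + 1) v j.val)) = ∑ j ∈ Iic k, H k j • (y j - T (y j)) :=
            sum_congr rfl fun j hj => by rw [hu j hj]
          rw [hs, hu k (mem_Iic.2 le_rfl)]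
          rcases Nat.lt_succ_iff_lt_or_eq.1 hk with h | h
          · rw [Function.update_of_ne (by omega), hy k h]
          · obtain rfl : k = ⟨m, hm⟩ := Fin.ext h
            rw [Function.update_self, hv]
      · exact ⟨y, h0, fun k _ => hy k (by omega)⟩
  obtain ⟨y, h0, hy⟩ := key n
  exact ⟨fun i => y i, h0, fun k => hy k k.2⟩

/-- The polynomials `p_k` with `y_k = p_k(T) y_0` for every linear operator `T`: the run of the
algorithm for multiplication by `X`, started at `1`. -/
structure IsPrimalRun (p : Fin (n + 1) → ℝ[X]) : Prop where
  zero : p 0 = 1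
  run : IsRun H (fun f => X * f) p

lemma exists_isPrimalRun : ∃ p, IsPrimalRun H p := by
  obtain ⟨p, h0, hp⟩ := exists_isRun H (fun f : ℝ[X] => X * f) 1
  exact ⟨p, h0, hp⟩

namespace IsPrimalRun
variable {H} {p : Fin (n + 1) → ℝ[X]} (hp : IsPrimalRun H p)
include hp

lemma step (k : Fin n) :
    p k.succ = p k.castSucc - (1 - X) * ∑ j ∈ Iic k, C (H k j) * p j.castSucc := by
  rw [hp.run k, mul_sum]
  congr 1
  refine sum_congr rfl fun j _ => ?_
  rw [smul_eq_C_mul]; ring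

/-- The primal and the dual recursion are transposes of each other, so both compute the
last iterate `y_n = p_n(T) y_0 = b_0(T) y_0`. -/
lemma last_eq {b : Fin (n + 1) → ℝ[X]} (hb : IsDualRun H b) : p (Fin.last n) = b 0 := by
  have t := (Fin.sum_univ_succ fun k => b k * p k).symm.trans
    (Fin.sum_univ_castSucc fun k => b k * p k)
  have e : ∑ k : Fin n, b k.succ * p k.succ = ∑ k : Fin n, b k.castSucc * p k.castSucc := by
    have e1 : ∀ k : Fin n, b k.succ * p k.succ = b k.succ * p k.castSucc
        - (1 - X) * ∑ j ∈ Iic k, C (H k j) * (b k.succ * p j.castSucc) := by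
      intro k
      rw [hp.step, mul_sub, mul_left_comm, mul_sum]
      congr 2
      exact sum_congr rfl fun j _ => by ring
    have e2 : ∀ k : Fin n, b k.castSucc * p k.castSucc = b k.succ * p k.castSucc
        - (1 - X) * ∑ i ∈ Ici k, C (H i k) * (b i.succ * p k.castSucc) := by
      intro k
      rw [hb.step, sub_mul, mul_assoc, sum_mul]
      congr 2
      exact sum_congr rfl fun j _ => by ring
    simp only [e1, e2, sum_sub_distrib, ← mul_sum]
    congr 2
    exact sum_comm' (by simp)
  rw [e, hp.zero, hb.last] at t
  linear_combination -t

/-- The polynomial `p_k` has degree at most `k`. -/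
lemma coeff_eq_zero (k : Fin (n + 1)) (d : ℕ) (h : k.val < d) : (p k).coeff d = 0 := by
  have key : ∀ m : ℕ, ∀ k : Fin (n + 1), k.val ≤ m → ∀ d : ℕ, k.val < d → (p k).coeff d = 0 := by
    intro m
    induction m with
    | zero =>
      intro k hk d hd
      obtain rfl : k = 0 := Fin.ext (by simpa using hk)
      rw [hp.zero, coeff_one, if_neg (by omega)]
    | succ m ih =>
      intro k
      refine Fin.cases (fun _ d hd => ?_) (fun j hj d hd => ?_) k
      · rw [hp.zero, coeff_one, if_neg (by omega)]
      rw [Fin.val_succ] at hj hd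
      obtain ⟨e, rfl⟩ : ∃ e, d = e + 1 := ⟨d - 1, by omega⟩
      rw [hp.step, coeff_sub, coeff_one_sub_X_mul_succ,
        ih j.castSucc (by rw [Fin.val_castSucc]; omega) _ (by rw [Fin.val_castSucc]; omega),
        finsetSum_coeff, finsetSum_coeff, sum_eq_zero, sum_eq_zero]
      · simp
      all_goals
        intro i hi
        have : i.val ≤ j := Fin.le_def.1 (mem_Iic.1 hi)
        rw [coeff_C_mul, ih i.castSucc (by rw [Fin.val_castSucc]; omega) _
          (by rw [Fin.val_castSucc]; omega), mul_zero]
  exact key _ k le_rfl d h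

lemma coeff_top (k : Fin n) :
    (p k.succ).coeff (k + 1) = H k k * (p k.castSucc).coeff k := by
  have hz : ∀ i : Fin n, i ≤ k → (p i.castSucc).coeff (k + 1) = 0 := by
    intro i hi
    have : i.val ≤ k := hi
    exact hp.coeff_eq_zero _ _ (by rw [Fin.val_castSucc]; omega)
  rw [hp.step, coeff_sub, coeff_one_sub_X_mul_succ, hz k le_rfl, finsetSum_coeff, finsetSum_coeff]
  rw [sum_eq_zero (f := fun j => (C (H k j) * p j.castSucc).coeff (k + 1)), sum_eq_single k]
  · rw [coeff_C_mul]; ring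
  · intro i hi hik
    have h1 : i.val ≤ k := Fin.le_def.1 (mem_Iic.1 hi)
    have h2 : i.val ≠ k := fun h => hik (Fin.ext h)
    rw [coeff_C_mul, hp.coeff_eq_zero _ _ (by rw [Fin.val_castSucc]; omega), mul_zero]
  · simp
  · intro i hi
    rw [coeff_C_mul, hz i (mem_Iic.1 hi), mul_zero]

lemma isRun_aeval {V : Type} [AddCommGroup V] [Module ℝ V] (U : V →ₗ[ℝ] V) (x : V) :
    IsRun H U (fun k => aeval U (p k) x) := by
  intro k
  have := congrArg (fun f => aeval U f x) (hp.run k)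
  simpa [map_sum, LinearMap.sum_apply] using this

end IsPrimalRun
end Runs

/-! ### The negacyclic shift -/

section Shift
variable (n : ℕ)

/-- The negacyclic shift `e_0 ↦ e_1 ↦ ⋯ ↦ e_n ↦ -e_0`, the extremal operator: every run of an
optimal algorithm for it attains the bound. -/
noncomputable def negShift :
    EuclideanSpace ℝ (Fin (n + 1)) →ₗ[ℝ] EuclideanSpace ℝ (Fin (n + 1)) where
  toFun v := WithLp.toLp 2
    (Fin.cons (α := fun _ => ℝ) (-v (Fin.last n)) fun i : Fin n => v i.castSucc)
  map_add' u v := by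
    ext i
    refine Fin.cases ?_ (fun i => ?_) i <;> simp
    ring
  map_smul' c v := by
    ext i
    refine Fin.cases ?_ (fun i => ?_) i <;> simp

@[simp] lemma negShift_zero (v : EuclideanSpace ℝ (Fin (n + 1))) :
    negShift n v 0 = -v (Fin.last n) := rfl

@[simp] lemma negShift_succ (v : EuclideanSpace ℝ (Fin (n + 1))) (i : Fin n) :
    negShift n v i.succ = v i.castSucc := rfl

lemma norm_negShift (v : EuclideanSpace ℝ (Fin (n + 1))) : ‖negShift n v‖ = ‖v‖ := by
  rw [EuclideanSpace.norm_eq, EuclideanSpace.norm_eq, Fin.sum_univ_succ, Fin.sum_univ_castSucc]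
  simp [add_comm]

lemma negShift_pow_single (d : ℕ) (hd : d ≤ n) :
    (negShift n ^ d) (EuclideanSpace.single 0 1) =
      EuclideanSpace.single (⟨d, Nat.lt_succ_iff.2 hd⟩ : Fin (n + 1)) (1 : ℝ) := by
  induction d with
  | zero => rfl
  | succ d ih =>
    rw [pow_succ', Module.End.mul_apply, ih (by omega)]
    ext i
    refine Fin.cases ?_ (fun i => ?_) i
    · rw [negShift_zero]
      simp [Fin.ext_iff]
      omega
    · rw [negShift_succ]
      simp [Fin.ext_iff]

lemma negShift_pow_succ_single :
    (negShift n ^ (n + 1)) (EuclideanSpace.single 0 1) = -EuclideanSpace.single 0 (1 : ℝ) := by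
  rw [pow_succ', Module.End.mul_apply, negShift_pow_single n n le_rfl]
  ext i
  refine Fin.cases ?_ (fun i => ?_) i
  · rw [negShift_zero]; simp [Fin.ext_iff]
  · rw [negShift_succ]; simp [Fin.ext_iff]; omega

lemma aeval_negShift_single (f : ℝ[X]) (hf : ∀ d, n < d → f.coeff d = 0) :
    aeval (negShift n) f (EuclideanSpace.single 0 1) =
      WithLp.toLp 2 (fun i : Fin (n + 1) => f.coeff i) := by
  have h : f.natDegree < n + 1 := Nat.lt_succ_iff.2 (natDegree_le_iff_coeff_eq_zero.2 hf)
  rw [aeval_eq_sum_range' h, LinearMap.sum_apply, sum_range]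
  ext i
  simp only [LinearMap.smul_apply, negShift_pow_single n _ (Nat.lt_succ_iff.1 (Fin.is_lt _))]
  simp [Pi.single_apply]

lemma negShift_ones :
    (WithLp.toLp 2 fun _ => 1) - negShift n (WithLp.toLp 2 fun _ => 1) =
      (2 : ℝ) • EuclideanSpace.single 0 (1 : ℝ) := by
  ext i
  refine Fin.cases ?_ (fun i => ?_) i
  · rw [PiLp.sub_apply, negShift_zero]; simp; norm_num
  · rw [PiLp.sub_apply, negShift_succ]; simp

end Shift

/-! ### Necessary conditions for optimality -/

section Optimal
variable {n : ℕ} {H : Matrix (Fin n) (Fin n) ℝ} {b : Fin (n + 1) → ℝ[X]}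

/-- Optimality forces `b_0 = (1 + X + ⋯ + X^n) / (n + 1)`. For the negacyclic shift `U` started at
the all-ones vector `v` the last residual is `b_0(U) (1 - U) v = 2 b_0(U) e_0`, twice the
coefficient vector of `b_0`. The bound then says that the squares of these coefficients sum to at
most `1 / (n + 1)`, while the coefficients sum to one. -/
theorem IsDualRun.coeff_zero_of_optimal (hb : IsDualRun H b) (hH : H ∈ optimalSet n) :
    ∀ d ≤ n, (b 0).coeff d = 1 / ((n : ℝ) + 1) := by
  obtain ⟨p, hp⟩ := exists_isPrimalRun H
  set one : EuclideanSpace ℝ (Fin (n + 1)) := WithLp.toLp 2 fun _ => 1 with hone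
  have key := hH.2 (EuclideanSpace ℝ (Fin (n + 1))) (negShift n)
    (fun u v => by rw [← map_sub, norm_negShift]) 0 (map_zero _) _ (hp.isRun_aeval (negShift n) one)
  simp only [hp.last_eq hb, hp.zero, map_one, sub_zero, Module.End.one_apply] at key
  have e1 : aeval (negShift n) (b 0) one - negShift n (aeval (negShift n) (b 0) one) =
      (2 : ℝ) • WithLp.toLp 2 (fun i : Fin (n + 1) => (b 0).coeff i) := by
    have : negShift n (aeval (negShift n) (b 0) one) =
        aeval (negShift n) (b 0) (negShift n one) := by
      have h := congrArg (fun f => aeval (negShift n) f one) (mul_comm X (b 0))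
      simpa using h
    rw [this, ← map_sub, hone, negShift_ones, map_smul, aeval_negShift_single n _ fun d hd =>
      hb.coeff_eq_zero 0 d (by simpa using hd)]
  have hN : (0 : ℝ) < (n : ℝ) + 1 := by positivity
  have e2 : ‖one‖ ^ 2 = (n : ℝ) + 1 := by
    rw [EuclideanSpace.norm_sq_eq]; simp [hone]
  have e3 : ∑ d ∈ range (n + 1), (b 0).coeff d ^ 2 ≤ 1 / ((n : ℝ) + 1) := by
    rw [e1, norm_smul, mul_pow, e2, EuclideanSpace.norm_sq_eq,
      ← Finset.sum_range fun d => ‖(b 0).coeff d‖ ^ 2] at key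
    simp only [Real.norm_eq_abs, sq_abs] at key
    rw [show 4 * ((n : ℝ) + 1) / (n + 1) ^ 2 = 2 ^ 2 * (1 / (n + 1)) by field_simp; norm_num] at key
    linarith
  -- equality case of the Cauchy–Schwarz inequality
  have e4 : ∑ d ∈ range (n + 1), ((b 0).coeff d - 1 / ((n : ℝ) + 1)) ^ 2 ≤ 0 := by
    have : ∀ d, ((b 0).coeff d - 1 / ((n : ℝ) + 1)) ^ 2 = (b 0).coeff d ^ 2
        - 2 / ((n : ℝ) + 1) * (b 0).coeff d + (1 / ((n : ℝ) + 1)) ^ 2 := fun d => by ring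
    simp only [this, sum_add_distrib, sum_sub_distrib, ← mul_sum, hb.sum_coeff, sum_const,
      card_range]
    rw [nsmul_eq_mul]
    push_cast
    have : ((n : ℝ) + 1) * (1 / ((n : ℝ) + 1)) ^ 2 = 1 / ((n : ℝ) + 1) := by field_simp
    rw [this]
    have : 2 / ((n : ℝ) + 1) = 2 * (1 / ((n : ℝ) + 1)) := by ring
    rw [this]
    linarith
  intro d hd
  have e5 := (sum_eq_zero_iff_of_nonneg fun _ _ => sq_nonneg _).1
    (le_antisymm e4 (sum_nonneg fun _ _ => sq_nonneg _)) d (mem_range.2 (Nat.lt_succ_iff.2 hd))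
  exact sub_eq_zero.1 (pow_eq_zero_iff two_ne_zero |>.1 e5)

end Optimal

section Perturb
open Filter Topology Asymptotics
variable {n : ℕ} {H : Matrix (Fin n) (Fin n) ℝ} {b : Fin (n + 1) → ℝ[X]}

lemma IsPrimalRun.coeff_self_ne_zero {p : Fin (n + 1) → ℝ[X]} (hp : IsPrimalRun H p)
    (h : (p (Fin.last n)).coeff n ≠ 0) (k : Fin (n + 1)) : (p k).coeff k ≠ 0 := by
  refine Fin.reverseInduction h (fun k hk => ?_) k
  rw [Fin.val_succ, hp.coeff_top] at hk
  exact right_ne_zero_of_mul hk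

/-- The coefficient vectors of `p_0, …, p_n` form a triangular matrix with nonzero diagonal, so a
linear functional may take any prescribed values on them. -/
lemma IsPrimalRun.exists_dual_vector {p : Fin (n + 1) → ℝ[X]} (hp : IsPrimalRun H p)
    (h : (p (Fin.last n)).coeff n ≠ 0) (c : Fin (n + 1) → ℝ) :
    ∃ a : EuclideanSpace ℝ (Fin (n + 1)),
      ∀ k, inner ℝ a (WithLp.toLp 2 fun i : Fin (n + 1) => (p k).coeff i) = c k := by
  set M : Matrix (Fin (n + 1)) (Fin (n + 1)) ℝ := Matrix.of fun k d => (p k).coeff d with hM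
  have hdet : IsUnit M.det := by
    rw [Matrix.det_of_isLowerTriangular M fun k d hkd => hp.coeff_eq_zero k d hkd]
    exact (prod_ne_zero_iff.2 fun k _ => hp.coeff_self_ne_zero h k).isUnit
  refine ⟨WithLp.toLp 2 (M⁻¹.mulVec c), fun k => ?_⟩
  have := congrFun (show M.mulVec (M⁻¹.mulVec c) = c by
    rw [Matrix.mulVec_mulVec, Matrix.mul_nonsing_inv _ hdet, Matrix.one_mulVec]) k
  rw [← this]
  simp [Matrix.mulVec, dotProduct, hM, PiLp.inner_apply, mul_comm]

/-- The negacyclic shift preceded by the map that moves the points of the half-space `⟪a, v⟫ < 0`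
towards its boundary, by `ε |⟪a, v⟫|` times `a`. It is nonexpansive for small `ε ≥ 0` and fixes
the origin. -/
noncomputable def bentShift (a : EuclideanSpace ℝ (Fin (n + 1))) (ε : ℝ)
    (v : EuclideanSpace ℝ (Fin (n + 1))) : EuclideanSpace ℝ (Fin (n + 1)) :=
  negShift n (v - (ε * min (inner ℝ a v) 0) • a)

lemma norm_sq_sub_norm_sq_bentShift (a : EuclideanSpace ℝ (Fin (n + 1))) (ε : ℝ)
    (u v : EuclideanSpace ℝ (Fin (n + 1))) :
    ‖u - v‖ ^ 2 - ‖bentShift a ε u - bentShift a ε v‖ ^ 2 =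
      ε * (2 * ((min (inner ℝ a u) 0 - min (inner ℝ a v) 0) * (inner ℝ a u - inner ℝ a v))
        - ε * ((min (inner ℝ a u) 0 - min (inner ℝ a v) 0) ^ 2 * ‖a‖ ^ 2)) := by
  rw [bentShift, bentShift, ← map_sub, norm_negShift]
  have : u - (ε * min (inner ℝ a u) 0) • a - (v - (ε * min (inner ℝ a v) 0) • a) =
      (u - v) - (ε * (min (inner ℝ a u) 0 - min (inner ℝ a v) 0)) • a := by
    rw [mul_sub, sub_smul]; abel
  rw [this, norm_sub_sq_real (u - v), norm_smul, real_inner_smul_right, mul_pow,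
    Real.norm_eq_abs, sq_abs, real_inner_comm a (u - v), inner_sub_right]
  ring

lemma norm_bentShift_sub_le (a : EuclideanSpace ℝ (Fin (n + 1))) {ε : ℝ} (h0 : 0 ≤ ε)
    (h1 : ε * ‖a‖ ^ 2 ≤ 2) (u v : EuclideanSpace ℝ (Fin (n + 1))) :
    ‖bentShift a ε u - bentShift a ε v‖ ≤ ‖u - v‖ := by
  refine le_of_sq_le_sq (sub_nonneg.1 ?_) (norm_nonneg _)
  rw [norm_sq_sub_norm_sq_bentShift]
  refine mul_nonneg h0 ?_
  set s := (inner ℝ a u : ℝ)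
  set t := (inner ℝ a v : ℝ)
  have h2 : (min s 0 - min t 0) ^ 2 ≤ (min s 0 - min t 0) * (s - t) := by
    rcases le_total s 0 with hs | hs <;> rcases le_total t 0 with ht | ht <;>
      simp only [min_eq_left, min_eq_right, hs, ht] <;> nlinarith
  have h3 := mul_le_mul_of_nonneg_right h1 (sq_nonneg (min s 0 - min t 0))
  linarith

/-- Residuals of the perturbed shift deviate from those of the shift by `O(ε)` along points that
do. -/
lemma isBigO_bentShift_sub {l : Filter ℝ} (a : EuclideanSpace ℝ (Fin (n + 1)))
    {y : ℝ → EuclideanSpace ℝ (Fin (n + 1))} {x : EuclideanSpace ℝ (Fin (n + 1))}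
    (hl : l ≤ 𝓝 0) (hy : (fun ε => y ε - x) =O[l] fun ε => ε) :
    (fun ε => (y ε - bentShift a ε (y ε)) - (x - negShift n x)) =O[l] fun ε => ε := by
  have ht : Tendsto y l (𝓝 x) := by
    have := hy.trans_tendsto (tendsto_id.mono_left hl)
    simpa using this.add_const x
  have h1 : (fun ε => negShift n (y ε - x)) =O[l] fun ε => ε :=
    (hy.norm_left.congr_left fun ε => (norm_negShift n _).symm).of_norm_left
  have h2 : (fun ε => min (inner ℝ a (y ε)) 0) =O[l] fun _ => (1 : ℝ) :=
    ((tendsto_const_nhds.inner ht).min tendsto_const_nhds).isBigO_one ℝ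
  have h3 : (fun ε => (ε * min (inner ℝ a (y ε)) 0) • negShift n a) =O[l] fun ε => ε := by
    have := ((isBigO_refl (fun ε : ℝ => ε) l).mul h2).smul
      (isBigO_refl (fun _ : ℝ => negShift n a) l)
    refine this.trans ?_
    simpa using (isBigO_refl (fun ε : ℝ => ε) l).smul
      (isBigO_const_const (negShift n a) (one_ne_zero' ℝ) l)
  refine ((hy.sub h1).add h3).congr_left fun ε => ?_
  rw [bentShift, map_sub, map_sub, map_smul]
  abel

/-- The first-order effect of bending the negacyclic shift. The real numbers `c_k` are the values
`⟪a, y_k⟫` on the unperturbed run from `e_0`. That run attains the bound with residual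
`2 e_0 / (n + 1)`, hence the left side of the certificate identity is at least `-O(ε²)` on the
perturbed run by optimality, while its right side is `ε` times the expression below, up to
`o(ε)`. -/
lemma IsDualRun.first_order_condition (hb : IsDualRun H b) (hH : H ∈ optimalSet n)
    (c : Fin (n + 1) → ℝ) :
    0 ≤ ∑ j, ∑ k, lam b j k * ((min (c j) 0 - min (c k) 0) * (c j - c k))
      + 2 * (min (c (Fin.last n)) 0 * c (Fin.last n)) := by
  obtain ⟨p, hp⟩ := exists_isPrimalRun H
  have h0 := hb.coeff_zero_of_optimal hH
  have hN : (0 : ℝ) < (n : ℝ) + 1 := by positivity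
  obtain ⟨a, ha⟩ := hp.exists_dual_vector
    (by rw [hp.last_eq hb, h0 n le_rfl]; positivity) c
  set e : EuclideanSpace ℝ (Fin (n + 1)) := EuclideanSpace.single 0 1 with he
  have hen : ‖e‖ = 1 := by simp [he]
  set x : Fin (n + 1) → EuclideanSpace ℝ (Fin (n + 1)) := fun k =>
    aeval (negShift n) (p k) e with hx
  have hxr : IsRun H (negShift n) x := hp.isRun_aeval (negShift n) e
  have hax : ∀ k, inner ℝ a (x k) = c k := by
    intro k
    rw [← ha k, hx]
    simp only [he]
    rw [aeval_negShift_single n _ fun d hd => hp.coeff_eq_zero k d (by omega)]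
  -- the unperturbed run attains the bound, since `(1 - X) b_0 = (1 - X ^ N) / N` and `U ^ N e = -e`
  have hxn : x (Fin.last n) - negShift n (x (Fin.last n)) = (2 / ((n : ℝ) + 1)) • e := by
    have hb0 : b 0 = C (1 / ((n : ℝ) + 1)) * ∑ i ∈ range (n + 1), X ^ i := by
      ext d
      rw [coeff_C_mul, finsetSum_coeff]
      simp only [coeff_X_pow, sum_ite_eq, mem_range]
      split_ifs with hd
      · rw [h0 d (Nat.lt_succ_iff.1 hd), mul_one]
      · rw [hb.coeff_eq_zero 0 d (by simpa using hd), mul_zero]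
    have h1 : (1 - X) * b 0 = C (1 / ((n : ℝ) + 1)) * (1 - X ^ (n + 1)) := by
      rw [hb0, ← mul_neg_geom_sum]; ring
    have h2 := congrArg (fun f => aeval (negShift n) f e) h1
    simp only [sub_mul, one_mul, map_sub, map_mul, aeval_X, map_pow, aeval_C, mul_sub,
      LinearMap.sub_apply, Module.End.mul_apply, Module.algebraMap_end_apply,
      negShift_pow_succ_single, mul_one, he] at h2
    simp only [hx, hp.last_eq hb, he]
    rw [h2, smul_neg, sub_neg_eq_add, ← add_smul]
    congr 1
    ring
  choose y hy0 hy using fun ε : ℝ => exists_isRun H (bentShift a ε) e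
  set l : Filter ℝ := 𝓝[>] 0 with hl
  have hl0 : l ≤ 𝓝 0 := nhdsWithin_le_nhds
  have hO : ∀ k, (fun ε => y ε k - x k) =O[l] fun ε => ε := by
    have key : ∀ m : ℕ, ∀ k : Fin (n + 1), k.val ≤ m → (fun ε => y ε k - x k) =O[l] fun ε => ε := by
      have hz : (fun ε => y ε 0 - x 0) =O[l] fun ε => ε := by
        simp only [hy0, hx, hp.zero, map_one, Module.End.one_apply, sub_self]
        exact isBigO_zero _ _
      intro m
      induction m with
      | zero =>
        intro k hk
        obtain rfl : k = 0 := Fin.ext (by simpa using hk)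
        exact hz
      | succ m ih =>
        intro k
        refine Fin.cases (fun _ => hz) (fun k hk => ?_) k
        rw [Fin.val_succ] at hk
        have h1 : ∀ j ∈ Iic k, (fun ε => H k j • ((y ε j.castSucc -
            bentShift a ε (y ε j.castSucc)) - (x j.castSucc - negShift n (x j.castSucc))))
            =O[l] fun ε => ε := by
          intro j hj
          have : j.val ≤ k := Fin.le_def.1 (mem_Iic.1 hj)
          exact (isBigO_bentShift_sub a hl0
            (ih j.castSucc (by rw [Fin.val_castSucc]; omega))).const_smul_left (H k j)
        refine ((ih k.castSucc (by rw [Fin.val_castSucc]; omega)).sub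
          (IsBigO.sum h1)).congr_left fun ε => ?_
        rw [hy ε k, hxr k]
        simp only [Finset.sum_apply, smul_sub, sum_sub_distrib]
        abel
    exact fun k => key _ k le_rfl
  have htend : ∀ k, Tendsto (fun ε => (inner ℝ a (y ε k) : ℝ)) l (𝓝 (c k)) := by
    intro k
    have := (hO k).trans_tendsto (tendsto_id.mono_left hl0)
    have h1 : Tendsto (fun ε => y ε k) l (𝓝 (x k)) := by simpa using this.add_const (x k)
    rw [← hax k]
    exact tendsto_const_nhds.inner h1
  have hmin : ∀ k, Tendsto (fun ε => min (inner ℝ a (y ε k) : ℝ) 0) l (𝓝 (min (c k) 0)) :=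
    fun k => (htend k).min tendsto_const_nhds
  have hε : Tendsto (fun ε : ℝ => ε) l (𝓝 0) := tendsto_id.mono_left hl0
  -- the right side of the certificate identity on the perturbed run, divided by `ε`
  set F : ℝ → ℝ := fun ε =>
    (∑ j, ∑ k, lam b j k *
      (2 * ((min (inner ℝ a (y ε j)) 0 - min (inner ℝ a (y ε k)) 0) *
        (inner ℝ a (y ε j) - inner ℝ a (y ε k)))
      - ε * ((min (inner ℝ a (y ε j)) 0 - min (inner ℝ a (y ε k)) 0) ^ 2 * ‖a‖ ^ 2))) / 2
    + (2 * ((min (inner ℝ a (y ε (Fin.last n))) 0) * (inner ℝ a (y ε (Fin.last n))))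
      - ε * ((min (inner ℝ a (y ε (Fin.last n))) 0) ^ 2 * ‖a‖ ^ 2)) with hF
  have hFt : Tendsto F l (𝓝 (
    (∑ j, ∑ k, lam b j k *
      (2 * ((min (c j) 0 - min (c k) 0) * (c j - c k))
      - 0 * ((min (c j) 0 - min (c k) 0) ^ 2 * ‖a‖ ^ 2))) / 2
    + (2 * ((min (c (Fin.last n)) 0) * (c (Fin.last n)))
      - 0 * ((min (c (Fin.last n)) 0) ^ 2 * ‖a‖ ^ 2)))) := by
    refine Tendsto.add (Tendsto.div_const (tendsto_finsetSum _ fun j _ =>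
      tendsto_finsetSum _ fun k _ => Tendsto.const_mul _ (Tendsto.sub
        (((hmin j).sub (hmin k)).mul ((htend j).sub (htend k)) |>.const_mul 2)
        (hε.mul ((((hmin j).sub (hmin k)).pow 2).mul_const _)))) 2)
      (Tendsto.sub (((hmin _).mul (htend _)).const_mul 2)
        (hε.mul (((hmin _).pow 2).mul_const _)))
  obtain ⟨C, hC⟩ := (isBigO_bentShift_sub a hl0 (hO (Fin.last n))).bound
  have hev : ∀ᶠ ε in l, -(((n : ℝ) + 1) / 2 * C ^ 2 * ε) ≤ F ε := by
    have hsmall : ∀ᶠ ε in l, ε * ‖a‖ ^ 2 ≤ 2 := by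
      have : Tendsto (fun ε : ℝ => ε * ‖a‖ ^ 2) l (𝓝 (0 * ‖a‖ ^ 2)) := hε.mul_const _
      rw [zero_mul] at this
      exact (this.eventually (gt_mem_nhds two_pos)).mono fun _ h => h.le
    filter_upwards [hC, hsmall, self_mem_nhdsWithin] with ε hCε hs hpos
    have hpos : 0 < ε := hpos
    have hfix : bentShift a ε 0 = 0 := by simp [bentShift]
    have hopt := hH.2 _ (bentShift a ε) (norm_bentShift_sub_le a hpos.le hs) 0 hfix (y ε) (hy ε)
    rw [hy0, sub_zero, hen] at hopt
    have id := hb.certificate_identity h0 (y ε) (fun k => y ε k - bentShift a ε (y ε k)) (hy ε)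
    have hlast : ‖y ε (Fin.last n)‖ ^ 2 - ‖bentShift a ε (y ε (Fin.last n))‖ ^ 2 =
      ε * (2 * ((min (inner ℝ a (y ε (Fin.last n))) 0) * (inner ℝ a (y ε (Fin.last n))))
      - ε * ((min (inner ℝ a (y ε (Fin.last n))) 0) ^ 2 * ‖a‖ ^ 2)) := by
      have := norm_sq_sub_norm_sq_bentShift a ε (y ε (Fin.last n)) 0
      rw [hfix, inner_zero_right] at this
      simpa only [sub_zero, min_self] using this
    simp only [sub_sub_cancel, norm_sq_sub_norm_sq_bentShift, hlast, mul_left_comm (lam b _ _) ε,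
      ← mul_sum] at id
    rw [mul_div_assoc, ← mul_add, hy0, hen] at id
    rw [hxn] at hCε
    set g := y ε (Fin.last n) - bentShift a ε (y ε (Fin.last n))
    set δ := g - (2 / ((n : ℝ) + 1)) • e with hδ
    have hg1 : g = (2 / ((n : ℝ) + 1)) • e + δ := by rw [hδ]; abel
    have hg2 : g - (1 / ((n : ℝ) + 1)) • e = (1 / ((n : ℝ) + 1)) • e + δ := by
      rw [hg1, add_sub_right_comm, ← sub_smul]
      congr 2; ring
    have expand : ∀ r : ℝ, ‖r • e + δ‖ ^ 2 = r ^ 2 + 2 * r * inner ℝ e δ + ‖δ‖ ^ 2 := by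
      intro r
      rw [norm_add_sq_real, norm_smul, hen, real_inner_smul_left, mul_one, Real.norm_eq_abs, sq_abs]
      ring
    rw [hg2, expand] at id
    rw [hg1, expand] at hopt
    have hδC : ‖δ‖ ^ 2 ≤ C ^ 2 * ε ^ 2 := by
      rw [← mul_pow]
      refine pow_le_pow_left₀ (norm_nonneg _) ?_ 2
      simpa [abs_of_pos hpos] using hCε
    -- optimality of the perturbed run: the residual cannot grow to first order
    have h5 : 4 * inner ℝ e δ ≤ -(((n : ℝ) + 1) * ‖δ‖ ^ 2) := by
      have e1 : 4 * (1 : ℝ) ^ 2 / ((n : ℝ) + 1) ^ 2 = (2 / ((n : ℝ) + 1)) ^ 2 := by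
        rw [div_pow]; norm_num
      rw [e1] at hopt
      have h6 : 2 * (2 / ((n : ℝ) + 1)) * inner ℝ e δ + ‖δ‖ ^ 2 ≤ 0 := by linarith
      have h7 := mul_le_mul_of_nonneg_left h6 hN.le
      have h8 : ((n : ℝ) + 1) * (2 * (2 / ((n : ℝ) + 1)) * inner ℝ e δ + ‖δ‖ ^ 2) =
        4 * inner ℝ e δ + ((n : ℝ) + 1) * ‖δ‖ ^ 2 := by field_simp; ring
      rw [h8, mul_zero] at h7
      linarith
    have h9 : (1 : ℝ) ^ 2 / ((n : ℝ) + 1) - ((n : ℝ) + 1) *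
        ((1 / ((n : ℝ) + 1)) ^ 2 + 2 * (1 / ((n : ℝ) + 1)) * inner ℝ e δ + ‖δ‖ ^ 2) =
        -(2 * inner ℝ e δ) - ((n : ℝ) + 1) * ‖δ‖ ^ 2 := by
      field_simp; ring
    rw [h9] at id
    have h10 := mul_le_mul_of_nonneg_left hδC (half_pos hN).le
    have h11 : ε * -(((n : ℝ) + 1) / 2 * C ^ 2 * ε) ≤ ε * F ε := by
      rw [hF]
      simp only
      rw [← id]
      linarith
    exact le_of_mul_le_mul_left h11 hpos
  have hlim : Tendsto (fun ε : ℝ => -(((n : ℝ) + 1) / 2 * C ^ 2 * ε)) l (𝓝 0) := by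
    simpa using (hε.const_mul (((n : ℝ) + 1) / 2 * C ^ 2)).neg
  have hres := le_of_tendsto_of_tendsto hlim hFt hev
  simp only [zero_mul, sub_zero, mul_left_comm (lam b _ _) 2, ← mul_sum] at hres
  linarith

/-- The certificates of an optimal matrix are nonnegative off the last vertex. In the first-order
condition take `c_j = -η`, `c_k = 1` and zero elsewhere; after division by `η`, only the pair
`{j, k}` survives the limit `η → 0`. -/
theorem IsDualRun.lam_nonneg (hb : IsDualRun H b) (hH : H ∈ optimalSet n) {j k : Fin (n + 1)}
    (hjk : j ≠ k) (hj : j ≠ Fin.last n) (hk : k ≠ Fin.last n) : 0 ≤ lam b j k := by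
  have key : ∀ η : ℝ, 0 < η → 0 ≤ η * (∑ i, lam b j i - lam b j j) + lam b j k := by
    intro η hη
    have h := hb.first_order_condition hH
      (fun i => (if i = k then 1 else 0) - η * (if i = j then 1 else 0))
    have hm : ∀ i : Fin (n + 1),
        min ((if i = k then (1 : ℝ) else 0) - η * (if i = j then 1 else 0)) 0 =
          -η * (if i = j then 1 else 0) := by
      intro i
      by_cases h1 : i = j
      · have : i ≠ k := h1 ▸ hjk
        simp [h1, hjk, hη.le]
      · by_cases h2 : i = k <;> simp [h2, h1, hjk.symm]
    simp only [hm, hj.symm, hk.symm, if_false, mul_zero, sub_zero, add_zero] at h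
    have e1 : ∀ r s : Fin (n + 1), lam b r s * ((-η * (if r = j then 1 else 0) -
        -η * (if s = j then 1 else 0)) * (((if r = k then (1 : ℝ) else 0) -
          η * (if r = j then 1 else 0)) - ((if s = k then (1 : ℝ) else 0) -
          η * (if s = j then 1 else 0)))) =
        (if r = j then lam b j s *
          (η * ((if s = k then 1 else 0) + η - η * (if s = j then 1 else 0))) else 0)
        + (if s = j then lam b j r *
          (η * ((if r = k then 1 else 0) + η - η * (if r = j then 1 else 0))) else 0) := by
      intro r s
      by_cases hr : r = j <;> by_cases hs : s = j
      · subst hr; subst hs; simp [hjk]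
      · subst hr; simp only [hs, hjk, if_true, if_false]; ring
      · subst hs; rw [lam_comm r s]; simp only [hr, hjk, if_true, if_false]; ring
      · simp [hr, hs]
    simp only [e1, sum_add_distrib, sum_ite_eq', mem_univ, if_true] at h
    rw [sum_comm] at h
    simp only [sum_ite_eq', mem_univ, if_true] at h
    have e2 : ∑ s, lam b j s * (η * ((if s = k then 1 else 0) + η - η * (if s = j then 1 else 0))) =
        η * (η * (∑ i, lam b j i - lam b j j) + lam b j k) := by
      have : ∀ s, lam b j s * (η * ((if s = k then 1 else 0) + η - η * (if s = j then 1 else 0))) =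
        η * (if s = k then lam b j s else 0) + η * η * lam b j s
          - η * η * (if s = j then lam b j s else 0) := by
        intro s; split_ifs <;> ring
      simp only [this, sum_add_distrib, sum_sub_distrib, ← mul_sum, sum_ite_eq', mem_univ, if_true]
      ring
    have h2 : 0 ≤ η * (η * (∑ i, lam b j i - lam b j j) + lam b j k) := by
      rw [← e2]
      linarith
    exact nonneg_of_mul_nonneg_right h2 hη
  have ht : Tendsto (fun η : ℝ => η * (∑ i, lam b j i - lam b j j) + lam b j k) (𝓝[>] 0)
      (𝓝 (0 * (∑ i, lam b j i - lam b j j) + lam b j k)) :=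
    ((tendsto_id.mono_left nhdsWithin_le_nhds).mul_const _).add_const _
  rw [zero_mul, zero_add] at ht
  exact ge_of_tendsto ht (eventually_nhdsWithin_of_forall key)

end Perturb

/-! ### Consequences of the invariants for the weights -/

section Structure
variable {n : ℕ} {H : Matrix (Fin n) (Fin n) ℝ} {b : Fin (n + 1) → ℝ[X]}

namespace IsDualRun

lemma coeff_top_ne_zero (hb : IsDualRun H b) (h0 : ∀ d ≤ n, (b 0).coeff d = 1 / ((n : ℝ) + 1))
    (i : Fin (n + 1)) : (b i).coeff (n - i) ≠ 0 := by
  refine Fin.induction ?_ (fun j hj => ?_) i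
  · rw [Fin.val_zero, Nat.sub_zero, h0 n le_rfl]; positivity
  · rw [Fin.val_castSucc, show n - j.val = (n - (j + 1)) + 1 by omega,
      hb.coeff_top j _ (by omega)] at hj
    rw [Fin.val_succ]
    exact right_ne_zero_of_mul hj

lemma weight_coeff_top_ne_zero (hb : IsDualRun H b)
    (h0 : ∀ d ≤ n, (b 0).coeff d = 1 / ((n : ℝ) + 1)) (i : Fin (n + 1)) :
    (weight b i).coeff (n - i) ≠ 0 := by
  refine Fin.lastCases (by simp) (fun j => ?_) i
  rw [weight_castSucc, coeff_sub, hb.coeff_eq_zero j.succ _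
    (by simp only [Fin.val_castSucc, Fin.val_succ]; omega), zero_sub]
  exact neg_ne_zero.2 (hb.coeff_top_ne_zero h0 _)

lemma lam_eq_zero_iff (j k : Fin (n + 1)) :
    lam b j k = 0 ↔ dot n (weight b j) (weight b k) = 0 := by
  have hN : -((n : ℝ) + 1) ≠ 0 := neg_ne_zero.2 (by positivity)
  rw [lam, mul_eq_zero, or_iff_right hN]

/-- The certificates on the last vertex sum to `n = N - 1`. -/
lemma sum_lam_last (hb : IsDualRun H b) (h0 : ∀ d ≤ n, (b 0).coeff d = 1 / ((n : ℝ) + 1)) :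
    ∑ j : Fin n, lam b j.castSucc (Fin.last n) = n := by
  have h := hb.sum_lam h0 (Fin.last n)
  rw [Fin.sum_univ_castSucc] at h
  have e1 : ∑ d ∈ range (n + 1), (weight b (Fin.last n)).coeff d = -1 := by
    simp [coeff_one]
  have e2 : lam b (Fin.last n) (Fin.last n) = -((n : ℝ) + 1) := by
    simp [lam, dot, coeff_one]
  rw [e1, e2] at h
  simp only [lam_comm (Fin.last n)] at h
  linarith

/-- If all certificates off the last vertex vanish, then `b_i` is the all-ones vector in degrees at
most `n - i`, divided by `n - i + 1`: by induction on `i` it is orthogonal to the weights of the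
columns `k = i, …, n - 1`, which span the vectors of coefficient sum zero in these degrees. -/
lemma coeff_eq_of_orthogonal (hb : IsDualRun H b)
    (h0 : ∀ d ≤ n, (b 0).coeff d = 1 / ((n : ℝ) + 1))
    (ho : ∀ j k : Fin n, j < k → lam b j.castSucc k.castSucc = 0) (i : Fin (n + 1)) (d : ℕ)
    (hd : d + i ≤ n) : (b i).coeff d = 1 / ((n : ℝ) - i + 1) := by
  have dot_sub : ∀ (f : ℝ[X]) (β : ℝ) (k : Fin n), dot n f (weight b k.castSucc) =
      ∑ e ∈ range (n + 1), (f.coeff e - β) * (weight b k.castSucc).coeff e := by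
    intro f β k
    simp only [sub_mul, sum_sub_distrib, ← mul_sum, hb.sum_coeff_weight, mul_zero, sub_zero]
    rfl
  have key : ∀ i : Fin (n + 1), ∃ c : ℝ, ∀ d, d + i ≤ n → (b i).coeff d = c := by
    intro i
    refine Fin.induction ⟨_, fun d hd => h0 d (by simpa using hd)⟩ (fun j ⟨c, hc⟩ => ?_) i
    refine ⟨(b j.succ).coeff 0, fun d => ?_⟩
    induction d using Nat.strong_induction_on with
    | _ d ih =>
      intro hd
      rw [Fin.val_succ] at hd
      rcases Nat.eq_zero_or_pos d with rfl | hpos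
      · rfl
      -- the column whose weight has degree exactly `d`; orthogonality to it fixes the coefficient
      -- of `b_{j+1}` in degree `d` once the lower ones are known to be equal
      obtain ⟨k, hk⟩ : ∃ k : Fin n, k.val = n - d := ⟨⟨n - d, by omega⟩, rfl⟩
      have hjk : j < k := Fin.lt_def.2 (by omega)
      have hw0 : ∀ e, d < e → (weight b k.castSucc).coeff e = 0 := fun e he =>
        hb.weight_coeff_eq_zero _ _ (by rw [Fin.val_castSucc]; omega)
      have z1 : dot n (b j.castSucc) (weight b k.castSucc) = 0 := by
        rw [dot_sub _ c]
        refine sum_eq_zero fun e _ => ?_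
        by_cases he : d < e
        · rw [hw0 e he, mul_zero]
        · rw [hc e (by rw [Fin.val_castSucc]; omega), sub_self, zero_mul]
      have z2 := (lam_eq_zero_iff _ _).1 (ho j k hjk)
      have z3 : dot n (b j.succ) (weight b k.castSucc) = 0 := by
        have : b j.succ = b j.castSucc + weight b j.castSucc := by rw [weight_castSucc]; ring
        rw [this]
        simp only [dot, coeff_add, add_mul, sum_add_distrib] at z1 z2 ⊢
        rw [z1, z2, add_zero]
      rw [dot_sub _ ((b j.succ).coeff 0), sum_eq_single d] at z3
      · have hne := hb.weight_coeff_top_ne_zero h0 k.castSucc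
        rw [Fin.val_castSucc, hk, show n - (n - d) = d by omega] at hne
        exact sub_eq_zero.1 ((mul_eq_zero.1 z3).resolve_right hne)
      · intro e _ hed
        rcases lt_or_gt_of_ne hed with he | he
        · rw [ih e he (by rw [Fin.val_succ]; omega), sub_self, zero_mul]
        · rw [hw0 e he, mul_zero]
      · intro h
        exact absurd (mem_range.2 (by omega)) h
  obtain ⟨c, hc⟩ := key i
  have hs := hb.sum_coeff i
  have hi : i.val ≤ n := Nat.lt_succ_iff.1 i.2
  rw [← sum_subset (range_subset_range.2 (show n - i + 1 ≤ n + 1 by omega)) (fun d _ h => by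
    rw [mem_range] at h
    exact hb.coeff_eq_zero i d (by omega)), sum_congr rfl (fun d h => hc d (by
    rw [mem_range] at h
    omega)), sum_const, card_range, nsmul_eq_mul] at hs
  push_cast [Nat.cast_sub hi] at hs
  rw [hc d hd]
  exact eq_one_div_of_mul_eq_one_right hs

/-- The dual run determines the lower triangular matrix, as the degrees of `b_1, …, b_n` differ. -/
lemma matrix_unique {H' : Matrix (Fin n) (Fin n) ℝ} (hb : IsDualRun H b) (hb' : IsDualRun H' b)
    (h0 : ∀ d ≤ n, (b 0).coeff d = 1 / ((n : ℝ) + 1))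
    (hH : ∀ k j : Fin n, k < j → H k j = 0) (hH' : ∀ k j : Fin n, k < j → H' k j = 0) :
    H = H' := by
  ext i j
  have hX : (1 - X : ℝ[X]) ≠ 0 := fun h => by
    have := congrArg (fun f => f.coeff 0) h
    simp at this
  have hs : ∑ i ∈ Ici j, C (H i j) * b i.succ = ∑ i ∈ Ici j, C (H' i j) * b i.succ :=
    mul_left_cancel₀ hX (sub_right_injective ((hb.step j).symm.trans (hb'.step j)))
  have key : ∀ m : ℕ, ∀ i : Fin n, i.val = m → H i j = H' i j := by
    intro m
    induction m using Nat.strong_induction_on with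
    | _ m ih =>
      intro i him
      by_cases hij : i < j
      · rw [hH i j hij, hH' i j hij]
      have hc := congrArg (fun f => f.coeff (n - (i + 1))) hs
      simp only [finsetSum_coeff, coeff_C_mul] at hc
      rw [← sub_eq_zero, ← sum_sub_distrib, sum_eq_single i, ← sub_mul] at hc
      · have hne := hb.coeff_top_ne_zero h0 i.succ
        rw [Fin.val_succ] at hne
        exact sub_eq_zero.1 ((mul_eq_zero.1 hc).resolve_right hne)
      · intro k _ hki
        rcases lt_or_gt_of_ne hki with h | h
        · rw [ih k.val (by rw [← him]; exact h) k rfl, sub_self]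
        · have := Fin.lt_def.1 h
          rw [hb.coeff_eq_zero k.succ _ (by rw [Fin.val_succ]; omega)]
          ring
      · intro h
        exact absurd (mem_Ici.2 (not_lt.1 hij)) h
  exact key _ i rfl

/-- If the certificates between the columns before `t` and the vertices after `t` vanish, the
weights of the former are supported in degrees at least `n - t`: they are orthogonal to the weights
of the latter, which span the lower degrees. Their inner products with the weight of `t` then see
only the degree `n - t`, and their coefficients there are known from the column sums. -/
lemma sum_lam_of_decomposable (hb : IsDualRun H b)
    (h0 : ∀ d ≤ n, (b 0).coeff d = 1 / ((n : ℝ) + 1)) (t : Fin n)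
    (ht : ∀ j k : Fin (n + 1), j < t.castSucc → t.castSucc < k → lam b j k = 0) :
    ∑ j ∈ Iio t, lam b j.castSucc t.castSucc = ((t : ℝ) + 1) * t / ((n : ℝ) + 1) := by
  have hN : (n : ℝ) + 1 ≠ 0 := by positivity
  have hz : ∀ j : Fin n, j < t → ∀ d < n - t.val, (weight b j.castSucc).coeff d = 0 := by
    intro j hj d
    induction d using Nat.strong_induction_on with
    | _ d ih =>
      intro hd
      obtain ⟨k, hk⟩ : ∃ k : Fin (n + 1), k.val = n - d := ⟨⟨n - d, by omega⟩, rfl⟩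
      have h1 := (lam_eq_zero_iff _ _).1 (ht j.castSucc k (Fin.castSucc_lt_castSucc_iff.2 hj)
        (Fin.lt_def.2 (by rw [Fin.val_castSucc]; omega)))
      rw [dot, sum_eq_single d] at h1
      · have hne := hb.weight_coeff_top_ne_zero h0 k
        rw [hk, show n - (n - d) = d by omega] at hne
        exact (mul_eq_zero.1 h1).resolve_right hne
      · intro e _ hed
        rcases lt_or_gt_of_ne hed with he | he
        · rw [ih e he (by omega), zero_mul]
        · rw [hb.weight_coeff_eq_zero k e (by omega), mul_zero]
      · intro h
        exact absurd (mem_range.2 (by omega)) h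
  -- column sums of the weights, restricted to the columns that reach degree `d`
  have hcol : ∀ (s : Finset (Fin n)) (d : ℕ), d ≤ n →
      (∀ j : Fin n, j ∉ s → (weight b j.castSucc).coeff d = 0) → 0 < d →
      ∑ j ∈ s, (weight b j.castSucc).coeff d = -(1 / ((n : ℝ) + 1)) := by
    intro s d hd hs hpos
    have h1 := congrArg (fun f => f.coeff d) hb.sum_weight
    simp only [finsetSum_coeff, coeff_neg, h0 d hd] at h1
    rw [Fin.sum_univ_castSucc, hb.weight_coeff_eq_zero (Fin.last n) d (by rw [Fin.val_last]; omega),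
      add_zero] at h1
    rw [← h1]
    exact sum_subset (subset_univ _) fun j _ hj => hs j hj
  set S := ∑ j ∈ Iio t, (weight b j.castSucc).coeff (n - t) with hS
  have htn : t.val < n := t.2
  have h1 : S + (weight b t.castSucc).coeff (n - t) = -(1 / ((n : ℝ) + 1)) := by
    rw [← hcol (insert t (Iio t)) (n - t) (by omega) ?_ (by omega), sum_insert (by simp), add_comm]
    intro j hj
    have : t.val < j := by
      simp only [mem_insert, mem_Iio, not_or, not_lt] at hj
      exact Fin.lt_def.1 (lt_of_le_of_ne hj.2 (Ne.symm hj.1))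
    exact hb.weight_coeff_eq_zero _ _ (by rw [Fin.val_castSucc]; omega)
  have h2 : S = t / ((n : ℝ) + 1) := by
    have e1 : ∑ d ∈ range (n + 1), ∑ j ∈ Iio t, (weight b j.castSucc).coeff d = 0 := by
      rw [sum_comm]
      exact sum_eq_zero fun j _ => hb.sum_coeff_weight j
    rw [show n + 1 = (n - t + 1) + t by omega, sum_range_add, sum_range_succ, sum_eq_zero,
      zero_add, ← hS] at e1
    · have e2 : ∀ i ∈ range t.val, ∑ j ∈ Iio t, (weight b j.castSucc).coeff (n - t + 1 + i) =
          -(1 / ((n : ℝ) + 1)) := by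
        intro i hi
        rw [mem_range] at hi
        refine hcol _ _ (by omega) (fun j hj => ?_) (by omega)
        have : t.val ≤ j := Fin.le_def.1 (not_lt.1 (by simpa using hj))
        exact hb.weight_coeff_eq_zero _ _ (by rw [Fin.val_castSucc]; omega)
      rw [sum_congr rfl e2, sum_const, card_range, nsmul_eq_mul] at e1
      rw [div_eq_mul_one_div]
      linarith
    · intro d hd
      exact sum_eq_zero fun j hj => hz j (mem_Iio.1 hj) d (mem_range.1 hd)
  have h3 : (weight b t.castSucc).coeff (n - t) = -((t : ℝ) + 1) / ((n : ℝ) + 1) := by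
    rw [h2] at h1
    field_simp at h1 ⊢
    linarith
  have h4 : ∀ j ∈ Iio t, lam b j.castSucc t.castSucc =
      ((t : ℝ) + 1) * (weight b j.castSucc).coeff (n - t) := by
    intro j hj
    rw [lam, dot, sum_eq_single (n - t.val), h3]
    · field_simp
    · intro e _ hed
      rcases lt_or_gt_of_ne hed with he | he
      · rw [hz j (mem_Iio.1 hj) e he, zero_mul]
      · rw [hb.weight_coeff_eq_zero t.castSucc e (by rw [Fin.val_castSucc]; omega), mul_zero]
    · intro h
      exact absurd (mem_range.2 (by omega)) h
  rw [sum_congr rfl h4, ← mul_sum, ← hS, h2]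
  ring

end IsDualRun
end Structure

/-! ### Dual-OHM -/

section Dual
variable (n : ℕ)

/-- The dual run of Dual-OHM: `b_i = (1 + X + ⋯ + X^{n-i}) / (n - i + 1)`. -/
noncomputable def dualOHMRun (i : Fin (n + 1)) : ℝ[X] :=
  C (1 / ((n : ℝ) - i + 1)) * ∑ d ∈ range (n - i + 1), X ^ d

lemma coeff_dualOHMRun (i : Fin (n + 1)) (d : ℕ) :
    (dualOHMRun n i).coeff d = if d + i ≤ n then 1 / ((n : ℝ) - i + 1) else 0 := by
  have hi : i.val ≤ n := Nat.lt_succ_iff.1 i.2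
  rw [dualOHMRun, coeff_C_mul, finsetSum_coeff]
  simp only [coeff_X_pow, sum_ite_eq, mem_range]
  have : d < n - i + 1 ↔ d + i ≤ n := by omega
  simp only [this]
  split_ifs <;> simp

lemma sum_Ioi_one_sub_X_pow (j : Fin n) :
    ∑ i ∈ Ioi j, (1 - X ^ (n - i.val) : ℝ[X]) =
      C ((n : ℝ) - j) - ∑ d ∈ range (n - j), X ^ d := by
  have hj := j.2
  have h1 : ∑ i ∈ Ioi j, (1 - X ^ (n - i.val) : ℝ[X]) = ∑ e ∈ Ico 1 (n - j.val), (1 - X ^ e) := by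
    refine sum_bij' (fun i _ => n - i.val)
      (fun e he => ⟨n - e, by rw [mem_Ico] at he; omega⟩) ?_ ?_ ?_ ?_ ?_
    · intro i hi
      have := Fin.lt_def.1 (mem_Ioi.1 hi)
      rw [mem_Ico]; omega
    · intro e he
      rw [mem_Ico] at he
      rw [mem_Ioi, Fin.lt_def]
      simp only
      omega
    · intro i hi
      have := i.2
      exact Fin.ext (by simp only; omega)
    · intro e he
      rw [mem_Ico] at he
      simp only
      omega
    · intro i _
      rfl
  have h2 : ∑ e ∈ range (n - j.val), (1 - X ^ e : ℝ[X]) =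
      C ((n : ℝ) - j) - ∑ d ∈ range (n - j), X ^ d := by
    rw [sum_sub_distrib, sum_const, card_range, nsmul_eq_mul, mul_one, ← Nat.cast_sub hj.le]
    simp
  rw [h1, ← h2, range_eq_Ico, sum_eq_sum_Ico_succ_bot (show 0 < n - j.val by omega)]
  simp

lemma isDualRun_dualOHMRun : IsDualRun (dualOHM n) (dualOHMRun n) where
  last := by simp [dualOHMRun]
  step j := by
    have hj := j.2
    have hM : (0 : ℝ) < (n : ℝ) - j := by
      rw [sub_pos]; exact_mod_cast hj
    have e1 : ∀ i : Fin n, (1 - X) * (C (dualOHM n i j) * dualOHMRun n i.succ) =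
        C (dualOHM n i j / ((n : ℝ) - i)) * (1 - X ^ (n - i.val)) := by
      intro i
      have hi := i.2
      rw [dualOHMRun, Fin.val_succ, show n - (i.val + 1) + 1 = n - i by omega, ← mul_neg_geom_sum]
      push_cast
      rw [show (n : ℝ) - (i + 1) + 1 = n - i by ring, div_eq_mul_one_div (dualOHM n i j), C_mul]
      ring
    have e2 : ∀ i ∈ Ioi j, C (dualOHM n i j / ((n : ℝ) - i)) * (1 - X ^ (n - i.val)) =
        C (-(1 / (((n : ℝ) - j) * ((n : ℝ) - j + 1)))) * (1 - X ^ (n - i.val)) := by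
      intro i hi
      have hi' : (0 : ℝ) < (n : ℝ) - i := by rw [sub_pos]; exact_mod_cast i.2
      rw [dualOHM, Matrix.of_apply, if_pos (mem_Ioi.1 hi)]
      congr 2
      field_simp
    have e3 : dualOHM n j j / ((n : ℝ) - j) = 1 / ((n : ℝ) - j + 1) := by
      rw [dualOHM, Matrix.of_apply, if_neg (lt_irrefl _), if_pos rfl]
      field_simp
    rw [mul_sum, sum_congr rfl fun i _ => e1 i, ← Ioi_insert j, sum_insert (by simp),
      sum_congr rfl e2, ← mul_sum, sum_Ioi_one_sub_X_pow, e3, dualOHMRun, dualOHMRun,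
      Fin.val_castSucc, Fin.val_succ, sum_range_succ, show n - (j.val + 1) + 1 = n - j by omega]
    push_cast
    rw [show (n : ℝ) - (j + 1) + 1 = n - j by ring]
    set S : ℝ[X] := ∑ d ∈ range (n - j.val), X ^ d
    have c1 : C (1 / (((n : ℝ) - j) * ((n : ℝ) - j + 1))) * C ((n : ℝ) - j) =
        C (1 / ((n : ℝ) - j + 1)) := by
      rw [← C_mul]; congr 1; field_simp
    have c2 : C (1 / ((n : ℝ) - j)) = C (1 / ((n : ℝ) - j + 1)) +
        C (1 / (((n : ℝ) - j) * ((n : ℝ) - j + 1))) := by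
      rw [← C_add]; congr 1; field_simp
    rw [C_neg, c2]
    linear_combination -c1

lemma dualRun_dualOHM : dualRun (dualOHM n) = dualOHMRun n :=
  (isDualRun_dualRun _).unique (isDualRun_dualOHMRun n)

lemma coeff_dualOHMRun_zero : ∀ d ≤ n, (dualOHMRun n 0).coeff d = 1 / ((n : ℝ) + 1) := by
  intro d hd
  rw [coeff_dualOHMRun, if_pos (by simpa using hd)]
  simp

/-- The weight of `j` is constant on the degrees that the weight of `k` reaches, and the latter has
coefficient sum zero. -/
lemma lam_dualOHM_eq_zero {j k : Fin n} (hjk : j < k) :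
    lam (dualOHMRun n) j.castSucc k.castSucc = 0 := by
  rw [IsDualRun.lam_eq_zero_iff]
  have hjk := Fin.lt_def.1 hjk
  have h : ∀ d, (weight (dualOHMRun n) j.castSucc).coeff d *
      (weight (dualOHMRun n) k.castSucc).coeff d =
      (1 / ((n : ℝ) - j) - 1 / ((n : ℝ) - j + 1)) * (weight (dualOHMRun n) k.castSucc).coeff d := by
    intro d
    by_cases hd : d + k ≤ n
    · rw [weight_castSucc, coeff_sub, coeff_dualOHMRun, coeff_dualOHMRun, Fin.val_succ,
        Fin.val_castSucc, if_pos (by omega), if_pos (by omega)]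
      push_cast
      rw [show (n : ℝ) - (j + 1) + 1 = n - j by ring]
    · rw [(isDualRun_dualOHMRun n).weight_coeff_eq_zero k.castSucc d
        (by rw [Fin.val_castSucc]; omega), mul_zero, mul_zero]
  rw [dot, sum_congr rfl fun d _ => h d, ← mul_sum, (isDualRun_dualOHMRun n).sum_coeff_weight,
    mul_zero]

lemma lam_dualOHM_last_pos (j : Fin n) : 0 < lam (dualOHMRun n) j.castSucc (Fin.last n) := by
  have hM : (0 : ℝ) < (n : ℝ) - j := by
    rw [sub_pos]; exact_mod_cast j.2
  have h : lam (dualOHMRun n) j.castSucc (Fin.last n) =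
      ((n : ℝ) + 1) * (weight (dualOHMRun n) j.castSucc).coeff 0 := by
    rw [lam, dot, sum_eq_single 0]
    · simp [-weight_castSucc]; ring
    · intro d _ hd
      simp [coeff_one, hd]
    · simp
  rw [h, weight_castSucc, coeff_sub, coeff_dualOHMRun, coeff_dualOHMRun, Fin.val_succ,
    Fin.val_castSucc, if_pos (by have := j.2; omega), if_pos (by have := j.2; omega)]
  push_cast
  rw [show (n : ℝ) - (j + 1) + 1 = n - j by ring]
  refine mul_pos (by positivity) (sub_pos.2 ?_)
  exact one_div_lt_one_div_of_lt hM (by linarith)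

end Dual

/-! ### The sum of the certificates -/

section Rho
variable {n : ℕ} (H : Matrix (Fin n) (Fin n) ℝ)

lemma cert_eq_lam (j : Fin n) (k : Fin (n + 1)) :
    cert H (k + 1) (j + 1) = lam (dualRun H) j.castSucc k := cert_eq_dot H j k

lemma rho_eq_add : rho H = ∑ j ∈ Icc 1 n, cert H (n + 1) j
    + ∑ j ∈ Icc 1 n, ∑ k ∈ Icc (j + 1) n, cert H k j := by
  rw [rho, ← sum_add_distrib]
  refine sum_congr rfl fun j hj => ?_
  rw [mem_Icc] at hj
  rw [sum_Icc_succ_top (by omega), add_comm]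

/-- Translation between indices counted from one and from zero, off the last vertex `N = n + 1`. -/
lemma forall_cert_iff (P : ℝ → Prop) :
    (∀ j ∈ Icc 1 n, ∀ k ∈ Icc (j + 1) n, P (cert H k j)) ↔
      ∀ j k : Fin n, j < k → P (lam (dualRun H) j.castSucc k.castSucc) := by
  constructor
  · intro h j k hjk
    have hjk := Fin.lt_def.1 hjk
    rw [← cert_eq_lam, Fin.val_castSucc]
    exact h _ (mem_Icc.2 (by omega)) _ (mem_Icc.2 (by omega))
  · intro h j hj k hk
    rw [mem_Icc] at hj hk
    have := h ⟨j - 1, by omega⟩ ⟨k - 1, by omega⟩ (Fin.lt_def.2 (by simp only; omega))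
    rw [← cert_eq_lam, Fin.val_castSucc] at this
    simp only at this
    rwa [show j - 1 + 1 = j by omega, show k - 1 + 1 = k by omega] at this

lemma sum_cert_last (h0 : ∀ d ≤ n, (dualRun H 0).coeff d = 1 / ((n : ℝ) + 1)) :
    ∑ j ∈ Icc 1 n, cert H (n + 1) j = n := by
  rw [sum_Icc_one_eq, sum_range, ← (isDualRun_dualRun H).sum_lam_last h0]
  exact sum_congr rfl fun j _ => cert_eq_lam H j (Fin.last n)

variable {H}

/-- The certificates `λ⋆_{N',j}` with `j < N'` alone contribute `N' (N' - 1) / N` on top of the sum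
`N - 1` of the certificates on the last vertex. -/
theorem le_rho_of_decomposableAt {m : ℕ} (hV : IsOptimalVertex H) (hD : DecomposableAt H m) :
    (n : ℝ) + (m : ℝ) * ((m : ℝ) - 1) / ((n : ℝ) + 1) ≤ rho H := by
  obtain ⟨⟨h1, h2⟩, -, h3⟩ := hD
  have hb := isDualRun_dualRun H
  have h0 := hb.coeff_zero_of_optimal hV.1
  have hnn : ∀ j ∈ Icc 1 n, ∀ k ∈ Icc (j + 1) n, 0 ≤ cert H k j := by
    intro j hj k hk
    rw [mem_Icc] at hk
    obtain ⟨k', -, hpos, hz⟩ := hV.2 j hj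
    by_cases h : k = k'
    · rw [h]; exact hpos.le
    · rw [hz k (mem_Icc.2 (by omega)) h]
  obtain ⟨t, rfl⟩ : ∃ t : Fin n, m = t + 1 := ⟨⟨m - 1, by omega⟩, by simp only; omega⟩
  have hblock := hb.sum_lam_of_decomposable h0 t (by
    intro j
    refine Fin.lastCases (fun k hj => ?_) (fun j k hj hk => ?_) j
    · exact absurd (hj.trans (Fin.castSucc_lt_last t)) (lt_irrefl _)
    · have hj := Fin.lt_def.1 hj
      have hk := Fin.lt_def.1 hk
      rw [Fin.val_castSucc] at hj hk
      rw [Fin.val_castSucc] at hj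
      rw [← cert_eq_lam]
      exact h3 _ (mem_Ico.2 (by omega)) _ (mem_Icc.2 (by omega)))
  have hsum : ∑ j ∈ Iio t, lam (dualRun H) j.castSucc t.castSucc =
      ∑ j ∈ Icc 1 t.val, cert H (t + 1) j := by
    rw [sum_Icc_one_eq, ← Nat.Iio_eq_range, ← Fin.map_valEmbedding_Iio, sum_map]
    exact sum_congr rfl fun j _ => (cert_eq_lam H j t.castSucc).symm
  have hle : ∑ j ∈ Icc 1 t.val, cert H (t + 1) j ≤
      ∑ j ∈ Icc 1 n, ∑ k ∈ Icc (j + 1) n, cert H k j := by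
    refine (sum_le_sum fun j hj => ?_).trans (sum_le_sum_of_subset_of_nonneg
      (Icc_subset_Icc le_rfl (by omega)) fun j hj _ => sum_nonneg (hnn j hj))
    rw [mem_Icc] at hj
    exact single_le_sum (f := fun k => cert H k j) (hnn j (mem_Icc.2 (by omega)))
      (mem_Icc.2 (by omega))
  rw [rho_eq_add, sum_cert_last H h0]
  refine add_le_add_right (le_trans (le_of_eq ?_) hle) _
  rw [← hsum, hblock]
  push_cast
  ring

/-- The certificates on the last vertex contribute `N - 1` and the others are nonnegative; if the
latter vanish, the dual run and with it the matrix is that of Dual-OHM. -/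
theorem le_rho_of_mem_optimalSet (hH : H ∈ optimalSet n) :
    (n : ℝ) ≤ rho H ∧ (rho H = n ↔ H = dualOHM n) := by
  have hb := isDualRun_dualRun H
  have h0 := hb.coeff_zero_of_optimal hH
  have hnn := (forall_cert_iff H (fun x => 0 ≤ x)).2 fun j k hjk => hb.lam_nonneg hH
    (fun h => hjk.ne (Fin.castSucc_injective _ h)) (Fin.castSucc_lt_last j).ne
    (Fin.castSucc_lt_last k).ne
  have hnn' : ∀ j ∈ Icc 1 n, 0 ≤ ∑ k ∈ Icc (j + 1) n, cert H k j :=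
    fun j hj => sum_nonneg (hnn j hj)
  rw [rho_eq_add, sum_cert_last H h0]
  refine ⟨le_add_of_nonneg_right (sum_nonneg hnn'), fun h => ?_, fun h => ?_⟩
  · have hz := (forall_cert_iff H (fun x => x = 0)).1 fun j hj k hk =>
      (sum_eq_zero_iff_of_nonneg (hnn j hj)).1
        ((sum_eq_zero_iff_of_nonneg hnn').1 (by linarith) j hj) k hk
    have hrun : dualRun H = dualOHMRun n := by
      funext i
      ext d
      rw [coeff_dualOHMRun]
      split_ifs with hd
      · exact hb.coeff_eq_of_orthogonal h0 hz i d hd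
      · exact hb.coeff_eq_zero i d (by omega)
    refine hb.matrix_unique (hrun ▸ isDualRun_dualOHMRun n) h0 hH.1 fun k j hkj => ?_
    rw [dualOHM, Matrix.of_apply, if_neg (not_lt.2 hkj.le), if_neg hkj.ne']
  · have hz := (forall_cert_iff H (fun x => x = 0)).2 fun j k hjk => by
      rw [h, dualRun_dualOHM]; exact lam_dualOHM_eq_zero n hjk
    rw [sum_eq_zero fun j hj => sum_eq_zero (hz j hj), add_zero]

theorem isOptimalVertex_dualOHM (n : ℕ) : IsOptimalVertex (dualOHM n) := by
  refine ⟨⟨fun k j hkj => ?_, ?_⟩, fun j hj => ?_⟩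
  · rw [dualOHM, Matrix.of_apply, if_neg (not_lt.2 hkj.le), if_neg hkj.ne']
  · intro V _ _ _ T hT z hz y hy
    refine (isDualRun_dualOHMRun n).norm_sq_le (coeff_dualOHMRun_zero n) ?_ T hT z hz y hy
    intro j k
    refine Fin.lastCases (fun h => absurd (Fin.le_last k) (not_le.2 h)) (fun j => ?_) j
    refine Fin.lastCases (fun _ => (lam_dualOHM_last_pos n j).le) (fun k h => ?_) k
    exact (lam_dualOHM_eq_zero n (Fin.castSucc_lt_castSucc_iff.1 h)).ge
  · have hz := (forall_cert_iff (dualOHM n) (fun x => x = 0)).2 fun j k hjk => by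
      rw [dualRun_dualOHM]; exact lam_dualOHM_eq_zero n hjk
    have hj' := mem_Icc.1 hj
    refine ⟨n + 1, mem_Icc.2 (by omega), ?_, fun l hl hne => ?_⟩
    · have := lam_dualOHM_last_pos n ⟨j - 1, by omega⟩
      rw [← dualRun_dualOHM, ← cert_eq_lam, Fin.val_last] at this
      simp only at this
      rwa [show j - 1 + 1 = j by omega] at this
    · rw [mem_Icc] at hl
      exact hz j hj l (mem_Icc.2 (by omega))

end Rho

end FixedPointH

theorem mainTheorem9 (n : ℕ) :
    -- vertices that are decomposable at `N'`
    (∀ (H : Matrix (Fin n) (Fin n) ℝ) (N' : ℕ),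
      FixedPointH.IsOptimalVertex H → FixedPointH.DecomposableAt H N' →
        (n : ℝ) + (N' : ℝ) * ((N' : ℝ) - 1) / ((n : ℝ) + 1) ≤ FixedPointH.rho H) ∧
    -- the minimum of `ρ` over all optimal matrices is `N - 1`, attained exactly by Dual-OHM
    (∀ H ∈ FixedPointH.optimalSet n,
      (n : ℝ) ≤ FixedPointH.rho H ∧
        (FixedPointH.rho H = (n : ℝ) ↔ H = FixedPointH.dualOHM n)) ∧
    FixedPointH.IsOptimalVertex (FixedPointH.dualOHM n) :=
  ⟨fun _ _ hV hD => FixedPointH.le_rho_of_decomposableAt hV hD,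
    fun _ hH => FixedPointH.le_rho_of_mem_optimalSet hH,
    FixedPointH.isOptimalVertex_dualOHM n⟩
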